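/- Let $\mu,a_1,a_2>0$, $p_1,p_2\in\mathbb R$, $T=p_1+p_2$, and consider $$\dot x(t)=-\mu x(t)+a(t)f(x(t-1)) \tag{$a,f$}$$ with the step functions $f=-\operatorname{sign}$ and $a$ ($T$-periodic, $a=a_1$ on $[0,p_1)$, $a=a_2$ on $[p_1,T)$). For $h>0$ put $$t_1(h)=\tfrac1\mu\ln\tfrac{h\mu+a_1}{a_1},\quad x_1=-\tfrac{a_1}\mu+\tfrac{a_1}\mu e^{-\mu},\quad t_2(h)=t_1(h)+1+\tfrac1\mu\ln\tfrac{a_1-\mu x_1}{a_1}$$ (the first two zeros of the solution with $x>0$ on $[-1,0]$, $x(0)=h$, and $x_1=x(t_1+1)$), and $F(h)=mh+b$ (the map $x(0)\mapsto x(T)$ of this discontinuous equation), where $$m=\Big[2\tfrac{a_2}{a_1}-e^{-\mu}\Big](2-e^{-\mu})e^{-\mu(T-2)},\qquad b=\tfrac{2a_2-a_1e^{-\mu}}{\mu}(2-e^{-\mu})e^{-\mu(T-2)}+\tfrac{a_1-a_2}{\mu}e^{-\mu p_2}-\tfrac{a_2}\mu .$$ Assume that $F$ has a fixed point $h_*>0$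 such that $t_2(h_*)<p_1<t_2(h_*)+1<T$, and that $m\neq1$. Smoothings: for $\delta,\rho>0$, let $\tilde f\in C^\infty(\mathbb R)$ satisfy $\tilde f(x)=-\operatorname{sign}(x)$ for $|x|\ge\delta$, $|\tilde f|\le 1$ on $[-\delta,\delta]$, and $J(-a_1/\mu,\tilde f)=J(-a_1/\mu,-\operatorname{sign})$, where $J(\alpha,g)=\frac{\alpha-\delta}{\mu}\int_{-\delta}^{\delta}\frac{g(u)}{(\alpha-u)^2}\,du$. Let $\tilde a\in C^\infty(\mathbb R)$ be $T$-periodic, $\tilde a=a_1$ on $[\rho,p_1]$, $\tilde a=a_2$ on $[p_1+\rho,T]$, $0<\tilde a\le 2\max\{a_1,a_2\}$ on $[0,\rho]\cup[p_1,p_1+\rho]$, with $\int_0^\rho(\tilde a(s)-a_1)e^{-\mu(\rho-s)}ds=0$ and $\int_{p_1}^{p_1+\rho}(\tilde a(s)-a_2)e^{-\mu(p_1+\rho-s)}ds=0$. Let $C^0=C^0([-1,0],\mathbb R)$ with the maximum norm. Then there are $r>0$ and $\rho_0>0$ such that for every $\varepsilon>0$ there is $\delta_0>0$ such that for all $\delta\in(0,\delta_0)$,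 $\rho\in(0,\rho_0)$ and all such smoothings $(\tilde a,\tilde f)$ the following hold. 1. Every initial state $\varphi\in C^0$ at time $0$ has a solution $x^\varphi$ on $[-1,\infty)$, whose segment on $[T-1,T]$ is uniquely determined by $\varphi$, so that the period map $P:C^0\to C^0$, $P\varphi=x^\varphi(T+\cdot)|_{[-1,0]}$, is defined. With $\tilde F(h):=(P(h\cdot\mathbf 1))(0)$ one has $(P\varphi)(0)=\tilde F(\varphi(0))$ whenever $\varphi\ge\delta$ on $[-1,0]$ and $|\varphi(0)-h_*|<r$. 2. There is exactly one $T$-periodic solution $\tilde p:\mathbb R\to\mathbb R$ of $(\tilde a,\tilde f)$ with $\tilde p\ge\delta$ on $[-1,0]$ and $|\tilde p(0)-h_*|<r$. Its initial state $\tilde\varphi=\tilde p|_{[-1,0]}$ satisfies $P(\tilde\varphi)=\tilde\varphi$, and $\tilde h:=\tilde\varphi(0)$ is the unique fixed point of $\tilde F$ in $(h_*-r,h_*+r)$. 3. $\tilde F$ is differentiable at $\tilde h$ with $\lambda:=\tilde F'(\tilde h)$, $P$ is Fréchet differentiable at $\tilde\varphi$ with $M:=DP(\tilde\varphi)$, and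 $|\tilde h-h_*|<\varepsilon$, $|\lambda-m|<\varepsilon$. In particular $\lambda\to m$ as $\delta\to0$. 4. If $m\ne0$, then $\lambda\neq0$ and there is a one-dimensional $C^1$-submanifold $W\ni\tilde\varphi$ of $C^0$ such that $P$ maps a neighbourhood of $\tilde\varphi$ in $C^0$ into $W$. Moreover $C^0=\mathcal N\oplus\mathcal T$, where $\mathcal N=\ker M$ is the eigenspace of $M$ for the eigenvalue $0$ and $\mathcal T=T_{\tilde\varphi}W$ is one-dimensional and is the eigenspace of $M$ for the eigenvalue $\lambda$ (so the decomposition is $M$-invariant). 5. If $m<1$, then $\tilde p$ is an asymptotically stable solution of $(\tilde a,\tilde f)$ (Lyapunov stable and locally attractive, for every starting time). -/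

import Mathlib

open Set Filter Topology
open scoped ContDiff

noncomputable section

namespace DelayEq

/-! ### The step equation `x' = -μ x + a(t) f(x(t-1))`, `f = -sign`, `a = a₁` on `[0,p₁)`, `a = a₂` on
`[p₁,p₁+p₂)`: explicit data of the solution with `x > 0` on `[-1,0]` and `x(0) = h`. -/

/-- First zero `t₁(h)` of the solution of the step equation. -/
def firstZero (μ a₁ h : ℝ) : ℝ := (1 / μ) * Real.log ((h * μ + a₁) / a₁)

/-- The value `x₁ = x(t₁ + 1)` of the solution of the step equation. -/
def xOne (μ a₁ : ℝ) : ℝ := -(a₁ / μ) + (a₁ / μ) * Real.exp (-μ)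

/-- Second zero `t₂(h)` of the solution of the step equation. -/
def secondZero (μ a₁ h : ℝ) : ℝ :=
  firstZero μ a₁ h + 1 + (1 / μ) * Real.log ((a₁ - μ * xOne μ a₁) / a₁)

/-- The slope `m` of the map `F(h) = m h + b`. -/
def mCoef (μ a₁ a₂ p₁ p₂ : ℝ) : ℝ :=
  (2 * (a₂ / a₁) - Real.exp (-μ)) * (2 - Real.exp (-μ)) * Real.exp (-μ * (p₁ + p₂ - 2))

/-- The constant term `b` of the map `F(h) = m h + b`. -/
def bCoef (μ a₁ a₂ p₁ p₂ : ℝ) : ℝ :=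
  (2 * a₂ - a₁ * Real.exp (-μ)) / μ * (2 - Real.exp (-μ)) * Real.exp (-μ * (p₁ + p₂ - 2))
    + (a₁ - a₂) / μ * Real.exp (-μ * p₂) - a₂ / μ

/-- The map `F : x(0) = h ↦ x(p₁ + p₂)` of the step equation, `F(h) = m h + b`. -/
def stepMap (μ a₁ a₂ p₁ p₂ h : ℝ) : ℝ := mCoef μ a₁ a₂ p₁ p₂ * h + bCoef μ a₁ a₂ p₁ p₂

/-! ### Smoothed data -/

/-- `J(α, g) = ((α - δ) / μ) ∫_{-δ}^{δ} g(u) / (α - u)² du`. -/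
def J (μ δ α : ℝ) (g : ℝ → ℝ) : ℝ :=
  (α - δ) / μ * ∫ u in (-δ)..δ, g u / (α - u) ^ 2

/-- `f` is a smoothing of `-sign` with parameter `δ`: it is `C^∞`, agrees with `-sign` for `|x| ≥ δ`,
has values in `[-1,1]`, and is balanced at the limit value `α = -a₁/μ`. -/
structure IsSmoothFeedback (μ a₁ δ : ℝ) (f : ℝ → ℝ) : Prop where
  smooth : ContDiff ℝ ∞ f
  eq_neg_sign : ∀ x, δ ≤ |x| → f x = -Real.sign x
  mem_Icc : ∀ x, |x| ≤ δ → f x ∈ Icc (-1 : ℝ) 1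
  balanced : J μ δ (-(a₁ / μ)) f = J μ δ (-(a₁ / μ)) (fun u => -Real.sign u)

/-- `a` is a smoothing, with transition length `ρ`, of the `(p₁+p₂)`-periodic step coefficient with
values `a₁` on `[0,p₁)` and `a₂` on `[p₁,p₁+p₂)`: on each of the two transition intervals the
exponentially weighted integrals of `a` and of the step coefficient agree. -/
structure IsSmoothCoefficient (μ a₁ a₂ p₁ p₂ ρ : ℝ) (a : ℝ → ℝ) : Prop where
  smooth : ContDiff ℝ ∞ a
  periodic : Function.Periodic a (p₁ + p₂)
  eq_first : ∀ t ∈ Icc ρ p₁, a t = a₁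
  eq_second : ∀ t ∈ Icc (p₁ + ρ) (p₁ + p₂), a t = a₂
  bound_first : ∀ t ∈ Icc 0 ρ, 0 < a t ∧ a t ≤ 2 * max a₁ a₂
  bound_second : ∀ t ∈ Icc p₁ (p₁ + ρ), 0 < a t ∧ a t ≤ 2 * max a₁ a₂
  weighted_first : ∫ s in (0 : ℝ)..ρ, a s * Real.exp (-μ * (ρ - s)) =
    ∫ s in (0 : ℝ)..ρ, a₁ * Real.exp (-μ * (ρ - s))
  weighted_second : ∫ s in p₁..(p₁ + ρ), a s * Real.exp (-μ * (p₁ + ρ - s)) =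
    ∫ s in p₁..(p₁ + ρ), a₂ * Real.exp (-μ * (p₁ + ρ - s))

/-! ### Solutions and the period map -/

/-- The phase space `C⁰([-1,0], ℝ)` with the maximum norm. -/
abbrev C0 : Type := C(Icc (-1 : ℝ) 0, ℝ)

/-- Evaluation at `0`. -/
def ev0 (φ : C0) : ℝ := φ ⟨0, by norm_num⟩

/-- `x`, considered on `[σ-1, ∞)`, is the solution of `x'(t) = -μ x(t) + a(t) f(x(t-1))`, `t ≥ σ`,
with initial state `φ` at time `σ` (at `t = σ` the derivative is the right-hand one). -/
structure IsSolutionFrom (μ : ℝ) (a f : ℝ → ℝ) (σ : ℝ) (φ : C0) (x : ℝ → ℝ) : Prop where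
  continuousOn : ContinuousOn x (Ici (σ - 1))
  initial : ∀ θ : Icc (-1 : ℝ) 0, x (σ + θ) = φ θ
  equation : ∀ t, σ ≤ t → HasDerivWithinAt x (-μ * x t + a t * f (x (t - 1))) (Ici σ) t

/-- `P` is the period map `φ ↦ x^φ_T`, from starting time `0` to time `T`: every initial state has a
solution, and `P φ` is the segment on `[T-1,T]` of every solution with initial state `φ`. -/
def IsPeriodMap (μ : ℝ) (a f : ℝ → ℝ) (T : ℝ) (P : C0 → C0) : Prop :=
  ∀ φ : C0, (∃ x, IsSolutionFrom μ a f 0 φ x) ∧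
    ∀ x, IsSolutionFrom μ a f 0 φ x → ∀ θ : Icc (-1 : ℝ) 0, P φ θ = x (T + θ)

/-- The one-dimensional map `h = x(0) ↦ x(T)`, computed with the constant initial state `h`. -/
def scalarMap (P : C0 → C0) (h : ℝ) : ℝ := ev0 (P (ContinuousMap.const _ h))

/-- `p : ℝ → ℝ` is a `T`-periodic solution on the whole real line. -/
structure IsPeriodicSolution (μ : ℝ) (a f : ℝ → ℝ) (T : ℝ) (p : ℝ → ℝ) : Prop where
  equation : ∀ t, HasDerivAt p (-μ * p t + a t * f (p (t - 1))) t
  periodic : Function.Periodic p T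

/-- (Lyapunov) stability together with local attraction, for every starting time `σ`. -/
def IsAsymptoticallyStable (μ : ℝ) (a f : ℝ → ℝ) (p : ℝ → ℝ) : Prop :=
  ∀ σ : ℝ,
    (∀ ε > 0, ∃ η > 0, ∀ (ψ : C0) (x : ℝ → ℝ), IsSolutionFrom μ a f σ ψ x →
      (∀ θ : Icc (-1 : ℝ) 0, |ψ θ - p (σ + θ)| < η) → ∀ t, σ ≤ t → |x t - p t| < ε) ∧
    (∃ η > 0, ∀ (ψ : C0) (x : ℝ → ℝ), IsSolutionFrom μ a f σ ψ x →
      (∀ θ : Icc (-1 : ℝ) 0, |ψ θ - p (σ + θ)| < η) →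
        Tendsto (fun t => x t - p t) atTop (𝓝 0))

/-! ### One-dimensional submanifolds -/

/-- `W` is a one-dimensional (embedded) `C¹` submanifold of the Banach space `E`: near each of its
points a `C¹` diffeomorphism between open sets of `E` straightens `W` to an open piece of a line. -/
def IsOneDimSubmanifold {E : Type*} [NormedAddCommGroup E] [NormedSpace ℝ E] (W : Set E) : Prop :=
  ∀ w ∈ W, ∃ (Φ : OpenPartialHomeomorph E E) (L : Submodule ℝ E),
    w ∈ Φ.source ∧ ContDiffOn ℝ 1 Φ Φ.source ∧ ContDiffOn ℝ 1 Φ.symm Φ.target ∧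
    Module.finrank ℝ L = 1 ∧ Φ '' (Φ.source ∩ W) = Φ.target ∩ (L : Set E)

/-- Tangent vectors to `W` at `w`: velocities at `w` of curves running in `W`. -/
def tangentVectors {E : Type*} [NormedAddCommGroup E] [NormedSpace ℝ E] (W : Set E) (w : E) :
    Set E :=
  {v | ∃ γ : ℝ → E, γ 0 = w ∧ (∀ᶠ t in 𝓝 0, γ t ∈ W) ∧ HasDerivAt γ v 0}

end DelayEq

end

/-! Write h = φ(0), θ = t₁(h), and let ω be the distance between the first two zeros. A solution
with φ ≥ δ sees the feedback value -1 on [0,1], so on one period it depends on φ only through h. The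
weighted-integral conditions on the coefficient make its transitions invisible once they are over.
After time ρ, and up to p₁, the solution is therefore the translate by θ of one fixed function, the
`profile` (`branch_eq_profile`).

At the first zero the balance condition enters. The substitution u = `descent` s turns the kernel
1/(α-u)² into the weight exp(μs) (`IsSmoothFeedback.integral_window`), so the smoothed feedback
contributes exactly what -sign contributes, and the second zero is again exactly θ + ω
(`profile_eq_ascent`). At the second zero no balance is assumed, and an error κ remains, the
`defect`. It is computed in time relative to θ and hence does not depend on h. So h ↦ x(T) is still
exactly affine, h ↦ λh + β, where λ - m and β - b are fixed multiples of κ (`branch_period`). Since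
κ is bounded in terms of the window half-length η alone (`abs_defect_le`), λ → m, and the fixed
point β/(1-λ) tends to h_*.

Near the fixed point P = G ∘ ev₀, where G(h) is the segment on [T-1,T] (`IsSolutionFrom.eq_branch`).
G is a C¹ curve in C⁰ because the `branch` is a single integral depending on the parameter θ
(`contDiff_branchSegment`). As ev₀ ∘ G is affine with slope λ, for λ ≠ 0 the image of G is a graph
over the evaluation (`isOneDimSubmanifold_image`), and DP is the rank-one operator ψ ↦ ψ(0) v with v
= G'(h̃), v(0) = λ. This gives the splitting. Stability reduces to |λ| < 1
(`IsPeriodMap.isAsymptoticallyStable`), and m > -1 holds automatically because T > t₂ + 1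
(`neg_one_lt_mCoef`). -/

namespace DelayEq

/-! ### Variation of constants, continuous dependence and existence -/

section General

variable {μ : ℝ} {a f : ℝ → ℝ} {σ : ℝ} {φ ψ : C0} {x y : ℝ → ℝ}

lemma continuousOn_rhs (ha : Continuous a) (hf : Continuous f) {s : ℝ}
    (hx : ContinuousOn x (Ici (s - 1))) :
    ContinuousOn (fun v => Real.exp (μ * v) * (a v * f (x (v - 1)))) (Ici s) := by
  have h1 : ContinuousOn (fun v => x (v - 1)) (Ici s) :=
    hx.comp (by fun_prop) (fun v hv => by simp only [mem_Ici] at *; linarith)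
  have h2 : ContinuousOn (fun v => f (x (v - 1))) (Ici s) := hf.comp_continuousOn h1
  exact (by fun_prop : ContinuousOn (fun v => Real.exp (μ * v)) (Ici s)).mul
    (ha.continuousOn.mul h2)

lemma intervalIntegrable_rhs (ha : Continuous a) (hf : Continuous f) {s t u : ℝ}
    (hx : ContinuousOn x (Ici (s - 1))) (ht : s ≤ t) (hu : s ≤ u) :
    IntervalIntegrable (fun v => Real.exp (μ * v) * (a v * f (x (v - 1))))
      MeasureTheory.volume t u := by
  apply ContinuousOn.intervalIntegrable
  apply (continuousOn_rhs ha hf hx).mono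
  intro v hv
  exact (le_min ht hu).trans hv.1

/-- Variation of constants. -/
lemma IsSolutionFrom.integral_eq (ha : Continuous a) (hf : Continuous f)
    (hx : IsSolutionFrom μ a f σ φ x) {s t : ℝ} (hs : σ ≤ s) (hst : s ≤ t) :
    Real.exp (μ * t) * x t =
      Real.exp (μ * s) * x s + ∫ v in s..t, Real.exp (μ * v) * (a v * f (x (v - 1))) := by
  have hder : ∀ v, σ ≤ v → HasDerivWithinAt (fun v => Real.exp (μ * v) * x v)
      (Real.exp (μ * v) * (a v * f (x (v - 1)))) (Ici σ) v := by
    intro v hv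
    have h1 : HasDerivAt (fun v => Real.exp (μ * v)) (Real.exp (μ * v) * (μ * 1)) v :=
      ((hasDerivAt_id v).const_mul μ).exp
    refine (h1.hasDerivWithinAt.mul (hx.equation v hv)).congr_deriv ?_
    ring
  have := intervalIntegral.integral_eq_sub_of_hasDeriv_right_of_le hst
    (f := fun v => Real.exp (μ * v) * x v)
    (f' := fun v => Real.exp (μ * v) * (a v * f (x (v - 1))))
    (fun v hv => ((hder v (hs.trans hv.1)).continuousWithinAt).mono
      (fun w hw => hs.trans hw.1))
    (fun v hv => (hder v (hs.trans hv.1.le)).mono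
      (fun w hw => (hs.trans hv.1.le).trans (le_of_lt hw)))
    (intervalIntegrable_rhs ha hf hx.continuousOn hs (hs.trans hst))
  rw [this]; ring

/-- A function satisfying the variation of constants formula is a solution. -/
lemma isSolutionFrom_of_integral_eq (ha : Continuous a) (hf : Continuous f)
    (hc : ContinuousOn x (Ici (σ - 1))) (hi : ∀ θ : Icc (-1 : ℝ) 0, x (σ + θ) = φ θ)
    (hx : ∀ t, σ ≤ t → Real.exp (μ * t) * x t =
      Real.exp (μ * σ) * x σ + ∫ v in σ..t, Real.exp (μ * v) * (a v * f (x (v - 1)))) :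
    IsSolutionFrom μ a f σ φ x := by
  refine ⟨hc, hi, fun t ht => ?_⟩
  set g := fun v => Real.exp (μ * v) * (a v * f (x (v - 1))) with hg
  have hgc : ContinuousOn g (Ici σ) := continuousOn_rhs ha hf hc
  have hI : HasDerivWithinAt (fun t => ∫ v in σ..t, g v) (g t) (Ici σ) t := by
    have hgi := intervalIntegrable_rhs (μ := μ) ha hf hc le_rfl ht
    rcases ht.eq_or_lt with h | h
    · subst h
      -- At the starting time the integrand is only known to be continuous from the right, so the
      -- one-sided fundamental theorem is needed.
      exact intervalIntegral.integral_hasDerivWithinAt_right hgi (s := Ici σ) (t := Ioi σ)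
        (hgc.mono Ioi_subset_Ici_self |>.stronglyMeasurableAtFilter_nhdsWithin measurableSet_Ioi σ)
        ((hgc σ self_mem_Ici).mono Ioi_subset_Ici_self)
    · have hn : Ici σ ∈ 𝓝 t := Ici_mem_nhds h
      exact (intervalIntegral.integral_hasDerivAt_right hgi
        ((hgc.mono Ioi_subset_Ici_self).stronglyMeasurableAtFilter isOpen_Ioi t h)
        (hgc.continuousAt hn)).hasDerivWithinAt
  have hE : HasDerivAt (fun t => Real.exp (-(μ * t))) (Real.exp (-(μ * t)) * (-(μ * 1))) t :=
    ((hasDerivAt_id t).const_mul μ).neg.exp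
  have hexp : ∀ t, Real.exp (-(μ * t)) * Real.exp (μ * t) = 1 := fun t => by
    rw [← Real.exp_add]; simp
  have hx' : ∀ t, σ ≤ t → x t =
      Real.exp (-(μ * t)) * (Real.exp (μ * σ) * x σ + ∫ v in σ..t, g v) := by
    intro t ht
    rw [← hx t ht, ← mul_assoc, hexp, one_mul]
  refine ((hE.hasDerivWithinAt.mul (hI.const_add (Real.exp (μ * σ) * x σ))).congr
    (fun u hu => hx' u hu) (hx' t ht)).congr_deriv ?_
  rw [hx' t ht, hg]
  dsimp only
  linear_combination (a t * f (x (t - 1))) * hexp t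

/-- Continuous dependence on initial data, with an explicit constant. -/
lemma abs_sub_le_of_isSolutionFrom (hμ : 0 < μ) (ha : Continuous a) {A : ℝ} {K : NNReal}
    (hA : ∀ t, |a t| ≤ A) (hK : LipschitzWith K f)
    (hx : IsSolutionFrom μ a f σ φ x) (hy : IsSolutionFrom μ a f σ ψ y) {d : ℝ}
    (hd : ∀ θ : Icc (-1 : ℝ) 0, |φ θ - ψ θ| ≤ d) (n : ℕ) :
    ∀ t, σ - 1 ≤ t → t ≤ σ + n → |x t - y t| ≤ d * (1 + A * K) ^ n := by
  have hA0 : 0 ≤ A := (abs_nonneg _).trans (hA 0)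
  have hd0 : 0 ≤ d := (abs_nonneg _).trans (hd ⟨0, by norm_num⟩)
  have hB : (1 : ℝ) ≤ 1 + A * K := by have := mul_nonneg hA0 K.coe_nonneg; linarith
  induction n with
  | zero =>
    intro t h1 h2
    simp only [Nat.cast_zero, add_zero] at h2
    have h3 : t - σ ∈ Icc (-1 : ℝ) 0 := ⟨by linarith, by linarith⟩
    have := hd ⟨t - σ, h3⟩
    rw [← hx.initial, ← hy.initial] at this
    simpa using this
  | succ n ih =>
    intro t h1 h2
    set D := d * (1 + A * K) ^ n with hD
    have hD0 : 0 ≤ D := by positivity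
    have hDs : d * (1 + A * K) ^ (n + 1) = D * (1 + A * K) := by rw [hD]; ring
    rw [hDs]
    rcases le_total t (σ + n) with h | h
    · exact (ih t h1 h).trans (le_mul_of_one_le_right hD0 hB)
    have hσn : σ ≤ σ + n := by linarith [(Nat.cast_nonneg n : (0 : ℝ) ≤ n)]
    push_cast at h2
    have e1 := hx.integral_eq ha hK.continuous hσn h
    have e2 := hy.integral_eq ha hK.continuous hσn h
    have i1 := intervalIntegrable_rhs (μ := μ) ha hK.continuous hx.continuousOn hσn (hσn.trans h)
    have i2 := intervalIntegrable_rhs (μ := μ) ha hK.continuous hy.continuousOn hσn (hσn.trans h)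
    have e3 : Real.exp (μ * t) * (x t - y t) = Real.exp (μ * (σ + n)) * (x (σ + n) - y (σ + n))
        + ∫ v in (σ + n)..t, (Real.exp (μ * v) * (a v * f (x (v - 1))) -
          Real.exp (μ * v) * (a v * f (y (v - 1)))) := by
      rw [intervalIntegral.integral_sub i1 i2]; linarith
    have hb : ‖∫ v in (σ + n)..t, (Real.exp (μ * v) * (a v * f (x (v - 1))) -
          Real.exp (μ * v) * (a v * f (y (v - 1))))‖ ≤
        (Real.exp (μ * t) * (A * (K * D))) * |t - (σ + n)| := by
      apply intervalIntegral.norm_integral_le_of_norm_le_const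
      intro v hv
      rw [uIoc_of_le h] at hv
      have hv1 := ih (v - 1) (by linarith [hv.1]) (by linarith [hv.2])
      have hv2 : |f (x (v - 1)) - f (y (v - 1))| ≤ K * D := by
        have := hK.dist_le_mul (x (v - 1)) (y (v - 1))
        rw [Real.dist_eq, Real.dist_eq] at this
        exact this.trans (mul_le_mul_of_nonneg_left hv1 K.coe_nonneg)
      rw [← mul_sub, ← mul_sub, Real.norm_eq_abs, abs_mul, abs_mul, Real.abs_exp]
      have : Real.exp (μ * v) ≤ Real.exp (μ * t) :=
        Real.exp_le_exp.2 (mul_le_mul_of_nonneg_left hv.2 hμ.le)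
      gcongr
      exact hA v
    rw [Real.norm_eq_abs, abs_of_nonneg (by linarith : (0 : ℝ) ≤ t - (σ + n))] at hb
    have hn := ih (σ + n) (by linarith) le_rfl
    have hE := Real.exp_pos (μ * t)
    -- As μ > 0 the weights increase; after division by the last one, a unit interval costs only the
    -- factor 1 + A K.
    have hEn : Real.exp (μ * (σ + n)) ≤ Real.exp (μ * t) :=
      Real.exp_le_exp.2 (mul_le_mul_of_nonneg_left h hμ.le)
    have h5 : Real.exp (μ * t) * |x t - y t| ≤ Real.exp (μ * t) * (D * (1 + A * K)) := by
      rw [← Real.abs_exp (μ * t), ← abs_mul, e3, Real.abs_exp]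
      refine (abs_add_le _ _).trans ?_
      rw [abs_mul, Real.abs_exp]
      have h6 : Real.exp (μ * (σ + n)) * |x (σ + n) - y (σ + n)| ≤ Real.exp (μ * t) * D := by
        gcongr
      have h7 : (Real.exp (μ * t) * (A * (K * D))) * (t - (σ + n)) ≤
          (Real.exp (μ * t) * (A * (K * D))) * 1 := by
        apply mul_le_mul_of_nonneg_left (by linarith)
        positivity
      nlinarith
    exact le_of_mul_le_mul_left h5 hE

lemma IsSolutionFrom.eq_of_isSolutionFrom (hμ : 0 < μ) (ha : Continuous a) {A : ℝ} {K : NNReal}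
    (hA : ∀ t, |a t| ≤ A) (hK : LipschitzWith K f)
    (hx : IsSolutionFrom μ a f σ φ x) (hy : IsSolutionFrom μ a f σ φ y) {t : ℝ}
    (ht : σ - 1 ≤ t) : x t = y t := by
  obtain ⟨n, hn⟩ := exists_nat_ge (t - σ)
  have := abs_sub_le_of_isSolutionFrom hμ ha hA hK hx hy (d := 0) (fun θ => by simp) n t ht
    (by linarith)
  rw [zero_mul] at this
  exact sub_eq_zero.1 (abs_nonpos_iff.1 this)

lemma IsSolutionFrom.apply_start (hx : IsSolutionFrom μ a f σ φ x) : x σ = ev0 φ := by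
  have := hx.initial ⟨0, by norm_num⟩
  simp only [add_zero] at this
  exact this

/-- Restriction of a solution to a later starting time. -/
lemma IsSolutionFrom.restart (hx : IsSolutionFrom μ a f σ φ x) {σ' : ℝ} (h : σ ≤ σ')
    (hψ : ∀ θ : Icc (-1 : ℝ) 0, x (σ' + θ) = ψ θ) : IsSolutionFrom μ a f σ' ψ x :=
  ⟨hx.continuousOn.mono (Ici_subset_Ici.2 (by linarith)), hψ, fun t ht =>
    (hx.equation t (h.trans ht)).mono (Ici_subset_Ici.2 h)⟩

/-- Translation of a solution by a period of the coefficient. -/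
lemma IsSolutionFrom.shift (hx : IsSolutionFrom μ a f σ φ x) {τ σ' : ℝ}
    (ha : Function.Periodic a τ) (hσ : σ' + τ = σ) :
    IsSolutionFrom μ a f σ' φ (fun t => x (t + τ)) := by
  subst hσ
  refine ⟨?_, fun θ => ?_, fun t ht => ?_⟩
  · exact hx.continuousOn.comp (by fun_prop) (fun v hv => by simp only [mem_Ici] at *; linarith)
  · rw [← hx.initial]; congr 1; ring
  · have h1 := hx.equation (t + τ) (by linarith)
    have h2 : HasDerivWithinAt (fun t : ℝ => t + τ) 1 (Ici σ') t :=
      ((hasDerivAt_id t).add_const τ).hasDerivWithinAt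
    have := h1.scomp t h2 (fun v hv => by simp only [mem_Ici] at *; linarith)
    rw [one_smul, ha t, show t + τ - 1 = t - 1 + τ by ring] at this
    exact this

/-- The segment of a solution ending at time `t`. -/
noncomputable def segment (x : ℝ → ℝ) (t : ℝ) (hx : ContinuousOn x (Ici (t - 1))) : C0 :=
  ⟨fun θ => x (t + θ), by
    apply hx.comp_continuous (by fun_prop)
    intro θ
    have := θ.2.1
    simp only [mem_Ici]; linarith⟩

/-- One step of the method of steps: solve the equation with the delayed term taken from `x`. -/
noncomputable def stepOperator (μ : ℝ) (a f : ℝ → ℝ) (φ : C0) (x : ℝ → ℝ) (t : ℝ) : ℝ :=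
  φ (projIcc (-1) 0 (by norm_num) t) - ev0 φ +
    Real.exp (-(μ * max t 0)) *
      (ev0 φ + ∫ v in (0 : ℝ)..max t 0, Real.exp (μ * v) * (a v * f (x (v - 1))))

lemma continuous_stepOperator (ha : Continuous a) (hf : Continuous f) (hx : Continuous x) :
    Continuous (stepOperator μ a f φ x) := by
  have h1 : Continuous fun t => φ (projIcc (-1) 0 (by norm_num) t) :=
    φ.continuous.comp continuous_projIcc
  have h2 : Continuous fun v => Real.exp (μ * v) * (a v * f (x (v - 1))) := by fun_prop
  have h3 : Continuous fun t : ℝ => ∫ v in (0 : ℝ)..t, Real.exp (μ * v) * (a v * f (x (v - 1))) :=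
    intervalIntegral.continuous_primitive (fun _ _ => h2.intervalIntegrable _ _) 0
  have h4 := h3.comp (by fun_prop : Continuous fun t : ℝ => max t 0)
  unfold stepOperator
  refine (h1.sub continuous_const).add (Continuous.mul (by fun_prop) (continuous_const.add h4))

/-- Causality with gain 1: because of the delay, each iteration extends the interval on which the
iterates have become stationary by one unit. -/
lemma stepOperator_congr {t : ℝ} (h : ∀ s, s ≤ max t 0 - 1 → x s = y s) :
    stepOperator μ a f φ x t = stepOperator μ a f φ y t := by
  unfold stepOperator
  congr 3
  apply intervalIntegral.integral_congr
  intro v hv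
  rw [uIcc_of_le (le_max_right _ _)] at hv
  simp only
  rw [h (v - 1) (by linarith [hv.2])]

lemma exists_isSolutionFrom (ha : Continuous a) (hf : Continuous f) (φ : C0) :
    ∃ x, IsSolutionFrom μ a f 0 φ x := by
  set X : ℕ → ℝ → ℝ := fun n => (stepOperator μ a f φ)^[n]
    (fun t => φ (projIcc (-1) 0 (by norm_num) t)) with hX
  have hsucc : ∀ n, X (n + 1) = stepOperator μ a f φ (X n) := fun n => by
    simp only [hX, Function.iterate_succ_apply']
  have hcont : ∀ n, Continuous (X n) := by
    intro n
    induction n with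
    | zero => exact φ.continuous.comp continuous_projIcc
    | succ n ih => rw [hsucc]; exact continuous_stepOperator ha hf ih
  have hneg : ∀ n t, t ≤ 0 → X n t = φ (projIcc (-1) 0 (by norm_num) t) := by
    intro n t ht
    cases n with
    | zero => rfl
    | succ n => rw [hsucc]; simp [stepOperator, max_eq_right ht]
  have hstep : ∀ n : ℕ, ∀ t : ℝ, t ≤ n → X (n + 1) t = X n t := by
    intro n
    induction n with
    | zero => intro t ht; rw [hneg 1 t (by simpa using ht), hneg 0 t (by simpa using ht)]
    | succ n ih =>
      intro t ht
      rw [hsucc (n + 1), hsucc n]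
      apply stepOperator_congr
      intro s hs
      rw [← hsucc]
      apply ih
      have : max t 0 ≤ n + 1 := max_le (by exact_mod_cast ht) (by positivity)
      linarith
  have hstable : ∀ n m : ℕ, n ≤ m → ∀ t : ℝ, t ≤ n → X m t = X n t := by
    intro n m hnm
    induction m, hnm using Nat.le_induction with
    | base => intros; rfl
    | succ m hm ih =>
      intro t ht
      rw [hstep m t (ht.trans (by exact_mod_cast hm)), ih t ht]
  -- Every index at least t gives the same value at t, so the limit is locally equal to one
  -- continuous iterate.
  set x : ℝ → ℝ := fun t => X ⌈t⌉₊ t with hx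
  have hxX : ∀ (n : ℕ) (t : ℝ), t ≤ n → x t = X n t := fun n t ht =>
    (hstable ⌈t⌉₊ n (Nat.ceil_le.2 ht) t (Nat.le_ceil t)).symm
  have hxc : Continuous x := by
    rw [continuous_iff_continuousAt]
    intro t
    obtain ⟨n, hn⟩ := exists_nat_gt t
    exact (hcont n).continuousAt.congr
      (Filter.eventually_of_mem (Iic_mem_nhds hn) (fun s hs => (hxX n s hs).symm))
  have hfix : ∀ t, 0 ≤ t → x t = stepOperator μ a f φ x t := by
    intro t ht
    obtain ⟨n, hn⟩ := exists_nat_ge t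
    rw [hxX (n + 1) t (by push_cast; linarith), hsucc]
    apply stepOperator_congr
    intro s hs
    rw [max_eq_left ht] at hs
    exact (hxX n s (by linarith)).symm
  have hx0 : x 0 = ev0 φ := by
    rw [hxX 0 0 (by simp), hneg 0 0 le_rfl, ev0, projIcc_of_mem]
  refine ⟨x, isSolutionFrom_of_integral_eq ha hf hxc.continuousOn (fun θ => ?_) (fun t ht => ?_)⟩
  · rw [zero_add, hxX 0 θ (by simpa using θ.2.2), hneg 0 θ θ.2.2, projIcc_val]
  · have h1 : φ (projIcc (-1) 0 (by norm_num) t) = ev0 φ := by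
      rw [projIcc_of_right_le _ ht]; rfl
    rw [hfix t ht, stepOperator, max_eq_left ht, h1, sub_self, zero_add, ← mul_assoc,
      ← Real.exp_add, hx0]
    simp

end General

end DelayEq

namespace DelayEq

/-! ### The profile: the solution through the first two zeros, in time relative to the first zero -/

section Feedback

variable {μ a₁ δ : ℝ} {f : ℝ → ℝ}

lemma IsSmoothFeedback.eq_neg_one (hf : IsSmoothFeedback μ a₁ δ f) (hδ : 0 < δ) {x : ℝ}
    (hx : δ ≤ x) : f x = -1 := by
  rw [hf.eq_neg_sign x (hx.trans (le_abs_self x)), Real.sign_of_pos (hδ.trans_le hx)]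

lemma IsSmoothFeedback.eq_one (hf : IsSmoothFeedback μ a₁ δ f) (hδ : 0 < δ) {x : ℝ}
    (hx : x ≤ -δ) : f x = 1 := by
  rw [hf.eq_neg_sign x (by rw [abs_of_neg (by linarith)]; linarith),
    Real.sign_of_neg (by linarith), neg_neg]

lemma IsSmoothFeedback.abs_le_one (hf : IsSmoothFeedback μ a₁ δ f) (hδ : 0 < δ) (x : ℝ) :
    |f x| ≤ 1 := by
  rcases le_total δ x with h | h
  · rw [hf.eq_neg_one hδ h]; simp
  rcases le_total x (-δ) with h' | h'
  · rw [hf.eq_one hδ h']; simp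
  · exact abs_le.2 (hf.mem_Icc x (abs_le.2 ⟨h', h⟩))

/-- The derivative vanishes outside [-δ,δ], hence is continuous with compact support and bounded. -/
lemma IsSmoothFeedback.exists_lipschitzWith (hf : IsSmoothFeedback μ a₁ δ f) (hδ : 0 < δ) :
    ∃ K, LipschitzWith K f := by
  have h1 : ContDiff ℝ 1 f := hf.smooth.of_le (by exact_mod_cast le_top)
  have hc : Continuous (deriv f) := h1.continuous_deriv le_rfl
  have hs : HasCompactSupport (deriv f) := by
    apply HasCompactSupport.intro (isCompact_Icc (a := -δ) (b := δ))
    intro x hx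
    rw [Set.mem_Icc, not_and_or, not_le, not_le] at hx
    rcases hx with hx | hx
    · have : f =ᶠ[𝓝 x] fun _ => 1 :=
        Filter.eventually_of_mem (Iio_mem_nhds hx) (fun y hy => hf.eq_one hδ (le_of_lt hy))
      rw [this.deriv_eq, deriv_const]
    · have : f =ᶠ[𝓝 x] fun _ => -1 :=
        Filter.eventually_of_mem (Ioi_mem_nhds hx) (fun y hy => hf.eq_neg_one hδ (le_of_lt hy))
      rw [this.deriv_eq, deriv_const]
  obtain ⟨C, hC⟩ := hs.exists_bound_of_continuous hc
  refine ⟨C.toNNReal, lipschitzWith_of_nnnorm_deriv_le (h1.differentiable one_ne_zero)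
    (fun x => ?_)⟩
  rw [← NNReal.coe_le_coe, coe_nnnorm]
  exact (hC x).trans (Real.le_coe_toNNReal C)

end Feedback

/-- The solution of `x' = -μ x - a₁` through `x 0 = 0`. -/
noncomputable def descent (μ a₁ t : ℝ) : ℝ := a₁ / μ * (Real.exp (-(μ * t)) - 1)

/-- The solution of `x'(t) = -μ x(t) + a₁ f(x₀(t-1))` through `x 0 = 0`, where `x₀` is `descent`. -/
noncomputable def profile (μ a₁ : ℝ) (f : ℝ → ℝ) (t : ℝ) : ℝ :=
  Real.exp (-(μ * t)) * ∫ s in (0 : ℝ)..t, Real.exp (μ * s) * (a₁ * f (descent μ a₁ (s - 1)))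

/-- `exp (μ ω)` for the distance `ω` of the first two zeros. -/
noncomputable def zeroGapExp (μ : ℝ) : ℝ := 2 * Real.exp μ - 1

/-- The distance `ω` of the first two zeros. -/
noncomputable def zeroGap (μ : ℝ) : ℝ := Real.log (zeroGapExp μ) / μ

/-- Compatibility of the threshold `δ` with the half-length `η` of the time windows around the
zeros inside which solutions may have modulus below `δ`. -/
structure Window (μ a₁ δ η : ℝ) : Prop where
  δ_pos : 0 < δ
  η_pos : 0 < η
  η_le : η ≤ 1 / 3
  small : Real.exp (μ * (1 + 2 * η)) + 1 ≤ 2 * Real.exp (μ * (1 - η))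
  width : μ * δ / a₁ ≤ 1 - Real.exp (-(μ * η))

lemma exp_neg_mul_exp (x : ℝ) : Real.exp (-x) * Real.exp x = 1 := by
  rw [← Real.exp_add]; simp

lemma integral_exp_mul {μ : ℝ} (hμ : 0 < μ) (s t : ℝ) :
    ∫ v in s..t, Real.exp (μ * v) = (Real.exp (μ * t) - Real.exp (μ * s)) / μ := by
  rw [intervalIntegral.integral_comp_mul_left (fun x => Real.exp x) hμ.ne', integral_exp,
    smul_eq_mul]
  field_simp

/-! ### Shape of the profile before, between and after the two zeros -/

section Profile

variable {μ a₁ δ η : ℝ} {f : ℝ → ℝ}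

lemma zeroGapExp_pos (hμ : 0 < μ) : 0 < zeroGapExp μ := by
  have : 1 < Real.exp μ := Real.one_lt_exp_iff.2 hμ
  unfold zeroGapExp; linarith

lemma exp_mul_zeroGap (hμ : 0 < μ) : Real.exp (μ * zeroGap μ) = zeroGapExp μ := by
  rw [zeroGap, mul_div_cancel₀ _ hμ.ne', Real.exp_log (zeroGapExp_pos hμ)]

lemma one_lt_zeroGap (hμ : 0 < μ) : 1 < zeroGap μ := by
  have h : Real.exp (μ * 1) < Real.exp (μ * zeroGap μ) := by
    rw [exp_mul_zeroGap hμ, mul_one, zeroGapExp]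
    have : 1 < Real.exp μ := Real.one_lt_exp_iff.2 hμ
    linarith
  exact lt_of_mul_lt_mul_left (Real.exp_lt_exp.1 h) hμ.le

/-- The field `width` controls times after a zero; the counterpart for times before it follows from
E + 1/E ≥ 2 with E = exp(μη). -/
lemma Window.one_add_width_le (hw : Window μ a₁ δ η) : 1 + μ * δ / a₁ ≤ Real.exp (μ * η) := by
  have h1 := Real.exp_pos (μ * η)
  have h2 := Real.exp_pos (-(μ * η))
  have h3 := exp_neg_mul_exp (μ * η)
  nlinarith [hw.width, sq_nonneg (Real.exp (μ * η) - 1)]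

lemma Window.le_of_exp (hμ : 0 < μ) (ha₁ : 0 < a₁) {z : ℝ} (h : 1 + μ * δ / a₁ ≤ z) :
    δ ≤ a₁ / μ * (z - 1) := by
  have : a₁ / μ * (μ * δ / a₁) ≤ a₁ / μ * (z - 1) :=
    mul_le_mul_of_nonneg_left (by linarith) (by positivity)
  have h2 : a₁ / μ * (μ * δ / a₁) = δ := by field_simp
  linarith

lemma Window.one_add_le_exp (hμ : 0 < μ) (hw : Window μ a₁ δ η) {t : ℝ} (ht : η ≤ t) :
    1 + μ * δ / a₁ ≤ Real.exp (μ * t) :=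
  hw.one_add_width_le.trans (Real.exp_le_exp.2 (mul_le_mul_of_nonneg_left ht hμ.le))

lemma Window.le_one_sub_exp (hμ : 0 < μ) (hw : Window μ a₁ δ η) {t : ℝ} (ht : η ≤ t) :
    μ * δ / a₁ ≤ 1 - Real.exp (-(μ * t)) :=
  hw.width.trans (by
    have : Real.exp (-(μ * t)) ≤ Real.exp (-(μ * η)) :=
      Real.exp_le_exp.2 (neg_le_neg (mul_le_mul_of_nonneg_left ht hμ.le))
    linarith)

lemma le_descent (hμ : 0 < μ) (ha₁ : 0 < a₁) (hw : Window μ a₁ δ η) {t : ℝ} (ht : t ≤ -η) :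
    δ ≤ descent μ a₁ t := by
  apply Window.le_of_exp hμ ha₁
  rw [← mul_neg]
  exact hw.one_add_le_exp hμ (by linarith)

lemma descent_le (hμ : 0 < μ) (ha₁ : 0 < a₁) (hw : Window μ a₁ δ η) {t : ℝ} (ht : η ≤ t) :
    descent μ a₁ t ≤ -δ := by
  have h := Window.le_of_exp (δ := δ) hμ ha₁ (z := 1 + (1 - Real.exp (-(μ * t))))
    (by linarith [hw.le_one_sub_exp hμ ht])
  have : descent μ a₁ t = -(a₁ / μ * (1 + (1 - Real.exp (-(μ * t))) - 1)) := by
    unfold descent; ring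
  linarith

lemma continuous_descent : Continuous (descent μ a₁) := by unfold descent; fun_prop

lemma integral_inv_sq {α p q : ℝ} (hp : -α < p) (hq : -α < q) :
    ∫ u in p..q, 1 / (-α - u) ^ 2 = (α + p)⁻¹ - (α + q)⁻¹ := by
  have hpos : ∀ u ∈ uIcc p q, -α - u ≠ 0 := fun u hu => by
    have : -α < u := (lt_min hp hq).trans_le hu.1
    exact (by linarith : -α - u < 0).ne
  rw [intervalIntegral.integral_eq_sub_of_hasDerivAt (f := fun u => (-α - u)⁻¹)]
  · rw [show -α - q = -(α + q) by ring, show -α - p = -(α + p) by ring, inv_neg, inv_neg]; ring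
  · intro u hu
    refine (((hasDerivAt_id u).const_sub (-α)).inv (hpos u hu)).congr_deriv ?_
    simp
  · apply ContinuousOn.intervalIntegrable
    exact continuousOn_const.div (by fun_prop) (fun u hu => pow_ne_zero 2 (hpos u hu))

/-- The balance condition, transported from space to time. -/
lemma IsSmoothFeedback.integral_window (hf : IsSmoothFeedback μ a₁ δ f) (hμ : 0 < μ) (ha₁ : 0 < a₁)
    (hw : Window μ a₁ δ η) :
    ∫ s in (-η)..η, Real.exp (μ * s) * f (descent μ a₁ s) =
      (Real.exp (μ * η) + Real.exp (-(μ * η)) - 2) / μ := by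
  set α := a₁ / μ with hα
  have hα0 : 0 < α := by positivity
  have hδ := hw.δ_pos
  have hη := hw.η_pos
  have hμα : μ * α = a₁ := by rw [hα]; field_simp
  -- This keeps the pole -α of the kernel outside [-δ,δ].
  have hδα : δ < α := by
    have h := hw.width
    rw [div_le_iff₀ ha₁, ← hμα] at h
    have h2 := Real.exp_pos (-(μ * η))
    have h3 : 0 < μ * α := by positivity
    have h4 : μ * δ < μ * α := by nlinarith
    exact lt_of_mul_lt_mul_left h4 hμ.le
  have hcf : Continuous f := hf.smooth.continuous
  have hgc : ContinuousOn (fun u => f u / (-α - u) ^ 2) (Ioi (-α)) :=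
    hcf.continuousOn.div (by fun_prop) (fun u hu => pow_ne_zero 2
      (by have : -α < u := hu; exact (by linarith : -α - u < 0).ne))
  have hgi : ∀ p q, -α < p → -α < q →
      IntervalIntegrable (fun u => f u / (-α - u) ^ 2) MeasureTheory.volume p q := fun p q hp hq =>
    (hgc.mono fun u hu => (lt_min hp hq).trans_le hu.1).intervalIntegrable
  -- the balanced part
  have hneg : ∫ u in (-δ)..0, -Real.sign u / (-α - u) ^ 2 = (α - δ)⁻¹ - α⁻¹ := by
    rw [show (α - δ)⁻¹ - α⁻¹ = (α + -δ)⁻¹ - (α + 0)⁻¹ by rw [add_zero, sub_eq_add_neg α],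
      ← integral_inv_sq (by linarith) (by linarith)]
    apply intervalIntegral.integral_congr_ae
    filter_upwards [MeasureTheory.Measure.ae_ne MeasureTheory.volume (0 : ℝ)] with u hu0 hu
    rw [uIoc_of_le (by linarith)] at hu
    rw [Real.sign_of_neg (lt_of_le_of_ne hu.2 hu0), neg_neg]
  have hpos : ∫ u in (0 : ℝ)..δ, -Real.sign u / (-α - u) ^ 2 = (α + δ)⁻¹ - α⁻¹ := by
    rw [show (α + δ)⁻¹ - α⁻¹ = -((α + 0)⁻¹ - (α + δ)⁻¹) by rw [add_zero]; ring,
      ← integral_inv_sq (by linarith) (by linarith), ← intervalIntegral.integral_neg]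
    apply intervalIntegral.integral_congr_ae
    filter_upwards with u hu
    rw [uIoc_of_le hδ.le] at hu
    rw [Real.sign_of_pos hu.1, neg_div]
  -- The sign is discontinuous at 0, so integrability is proved separately on each side, where it is
  -- constant almost everywhere.
  have hsgn : ∀ p q, p ≤ 0 ∧ q ≤ 0 ∧ -α < p ∧ -α < q ∨ 0 ≤ p ∧ 0 ≤ q →
      IntervalIntegrable (fun u => -Real.sign u / (-α - u) ^ 2) MeasureTheory.volume p q := by
    intro p q h
    have hc : IntervalIntegrable (fun u => 1 / (-α - u) ^ 2) MeasureTheory.volume p q := by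
      apply ContinuousOn.intervalIntegrable
      refine continuousOn_const.div (by fun_prop) (fun u hu => pow_ne_zero 2 ?_)
      have : -α < u := by
        rcases h with h | h
        · exact (lt_min h.2.2.1 h.2.2.2).trans_le hu.1
        · linarith [(le_min h.1 h.2).trans hu.1]
      exact (by linarith : -α - u < 0).ne
    rcases h with h | h
    · refine hc.congr_ae ?_
      rw [Filter.EventuallyEq, MeasureTheory.ae_restrict_iff' measurableSet_uIoc]
      filter_upwards [MeasureTheory.Measure.ae_ne MeasureTheory.volume (0 : ℝ)] with u hu0 hu
      rw [Real.sign_of_neg (lt_of_le_of_ne (hu.2.trans (max_le h.1 h.2.1)) hu0), neg_neg]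
    · refine hc.neg.congr_ae ?_
      rw [Filter.EventuallyEq, MeasureTheory.ae_restrict_iff' measurableSet_uIoc]
      filter_upwards with u hu
      simp only [Pi.neg_apply]
      rw [Real.sign_of_pos ((le_min h.1 h.2).trans_lt hu.1), neg_div]
  have hbal : ∫ u in (-δ)..δ, f u / (-α - u) ^ 2 = (α - δ)⁻¹ + (α + δ)⁻¹ - 2 * α⁻¹ := by
    have h := hf.balanced
    unfold J at h
    rw [← hα] at h
    have h2 : (-α - δ) / μ ≠ 0 := div_ne_zero (by linarith) hμ.ne'
    rw [mul_left_cancel₀ h2 h, ← intervalIntegral.integral_add_adjacent_intervals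
      (hsgn (-δ) 0 (Or.inl ⟨by linarith, le_rfl, by linarith, by linarith⟩))
      (hsgn 0 δ (Or.inr ⟨le_rfl, hδ.le⟩)), hneg, hpos]
    ring
  -- substitution
  have hder : ∀ s, HasDerivAt (descent μ a₁) (-(a₁ * Real.exp (-(μ * s)))) s := by
    intro s
    refine ((((hasDerivAt_id s).const_mul μ).neg.exp.sub_const 1).const_mul (a₁ / μ)).congr_deriv ?_
    simp only [Pi.neg_apply, id_eq]
    field_simp
  have hval : ∀ s, -α - descent μ a₁ s = -(α * Real.exp (-(μ * s))) := by
    intro s; unfold descent; rw [← hα]; ring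
  have hgt : ∀ s, -α < descent μ a₁ s := by
    intro s
    have := mul_pos hα0 (Real.exp_pos (-(μ * s)))
    linarith [hval s]
  have hsub := intervalIntegral.integral_comp_mul_deriv'' (a := -η) (b := η)
    (f := descent μ a₁) (f' := fun s => -(a₁ * Real.exp (-(μ * s))))
    (g := fun u => f u / (-α - u) ^ 2) continuous_descent.continuousOn
    (fun s _ => (hder s).hasDerivWithinAt) (by fun_prop)
    (hgc.mono (by rintro _ ⟨s, _, rfl⟩; exact hgt s))
  -- With u = `descent` s one has α + u = α exp(-μs) and du = -μα exp(-μs) ds, so du/(α+u)² = -(μ/α)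
  -- exp(μs) ds: exactly the weight of the variation of constants formula.
  have hint : ∀ s, ((fun u => f u / (-α - u) ^ 2) ∘ descent μ a₁) s *
      -(a₁ * Real.exp (-(μ * s))) = (-(μ / α)) * (Real.exp (μ * s) * f (descent μ a₁ s)) := by
    intro s
    simp only [Function.comp_apply]
    rw [hval, ← hμα, Real.exp_neg]
    have := (Real.exp_pos (μ * s)).ne'
    field_simp
  simp_rw [hint] at hsub
  rw [intervalIntegral.integral_const_mul] at hsub
  have hA := descent_le hμ ha₁ hw (le_refl η)
  have hB := le_descent hμ ha₁ hw (le_refl (-η))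
  have hAα := hgt η
  set A := descent μ a₁ η with hA'
  set B := descent μ a₁ (-η) with hB'
  -- Outside [-δ,δ] the feedback is ±1, so f enters the window integral only through the balanced
  -- part.
  have i1 : ∫ u in A..(-δ), f u / (-α - u) ^ 2 = (α + A)⁻¹ - (α - δ)⁻¹ := by
    rw [sub_eq_add_neg α, ← integral_inv_sq hAα (by linarith)]
    apply intervalIntegral.integral_congr
    intro u hu
    rw [uIcc_of_le hA] at hu
    simp only
    rw [hf.eq_one hδ hu.2]
  have i2 : ∫ u in δ..B, f u / (-α - u) ^ 2 = (α + B)⁻¹ - (α + δ)⁻¹ := by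
    rw [show (α + B)⁻¹ - (α + δ)⁻¹ = -((α + δ)⁻¹ - (α + B)⁻¹) by ring,
      ← integral_inv_sq (by linarith) (by linarith), ← intervalIntegral.integral_neg]
    apply intervalIntegral.integral_congr
    intro u hu
    rw [uIcc_of_le hB] at hu
    simp only
    rw [hf.eq_neg_one hδ hu.1, neg_div]
  have htot : ∫ u in A..B, f u / (-α - u) ^ 2 = (α + A)⁻¹ + (α + B)⁻¹ - 2 * α⁻¹ := by
    rw [← intervalIntegral.integral_add_adjacent_intervals (b := -δ)
      (hgi _ _ hAα (by linarith)) (hgi _ _ (by linarith) (by linarith)),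
      ← intervalIntegral.integral_add_adjacent_intervals (a := -δ) (b := δ)
      (hgi _ _ (by linarith) (by linarith)) (hgi _ _ (by linarith) (by linarith)), i1, i2, hbal]
    ring
  rw [intervalIntegral.integral_symm A B, htot] at hsub
  have hA2 : α + A = α * Real.exp (-(μ * η)) := by linarith [hval η]
  have hB2 : α + B = α * Real.exp (μ * η) := by
    have := hval (-η)
    rw [mul_neg, neg_neg] at this
    linarith
  rw [hA2, hB2, Real.exp_neg] at hsub
  rw [Real.exp_neg]
  have hE := (Real.exp_pos (μ * η)).ne'
  set I := ∫ s in (-η)..η, Real.exp (μ * s) * f (descent μ a₁ s)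
  have : I = -(α / μ) * (-(μ / α) * I) := by field_simp
  rw [this, hsub]
  field_simp

lemma continuous_profile_integrand (hf : Continuous f) :
    Continuous fun s => Real.exp (μ * s) * (a₁ * f (descent μ a₁ (s - 1))) := by
  have := continuous_descent (μ := μ) (a₁ := a₁)
  fun_prop

lemma exp_mul_profile (t : ℝ) : Real.exp (μ * t) * profile μ a₁ f t =
    ∫ s in (0 : ℝ)..t, Real.exp (μ * s) * (a₁ * f (descent μ a₁ (s - 1))) := by
  rw [profile, ← mul_assoc, mul_comm (Real.exp (μ * t)), exp_neg_mul_exp, one_mul]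

lemma exp_mul_profile_eq_add (hf : Continuous f) (s t : ℝ) :
    Real.exp (μ * t) * profile μ a₁ f t = Real.exp (μ * s) * profile μ a₁ f s +
      ∫ v in s..t, Real.exp (μ * v) * (a₁ * f (descent μ a₁ (v - 1))) := by
  rw [exp_mul_profile, exp_mul_profile, intervalIntegral.integral_add_adjacent_intervals] <;>
  exact (continuous_profile_integrand hf).intervalIntegrable _ _

lemma hasDerivAt_profile (hf : Continuous f) (t : ℝ) :
    HasDerivAt (profile μ a₁ f) (-μ * profile μ a₁ f t + a₁ * f (descent μ a₁ (t - 1))) t := by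
  have hc := continuous_profile_integrand (μ := μ) (a₁ := a₁) hf
  have h1 := (hc.integral_hasStrictDerivAt 0 t).hasDerivAt
  have h2 := ((hasDerivAt_id t).const_mul μ).neg.exp
  refine (h2.mul h1).congr_deriv ?_
  simp only [Pi.neg_apply, id_eq]
  rw [profile]
  linear_combination (a₁ * f (descent μ a₁ (t - 1))) * exp_neg_mul_exp (μ * t)

lemma continuous_profile (hf : Continuous f) : Continuous (profile μ a₁ f) :=
  continuous_iff_continuousAt.2 fun t => (hasDerivAt_profile hf t).continuousAt

/-- The delayed argument is at most -η, where the feedback is still -1. Negative times are included,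
so the profile also describes the solution before its first zero. -/
lemma profile_eq_descent (hf : IsSmoothFeedback μ a₁ δ f) (hμ : 0 < μ) (ha₁ : 0 < a₁)
    (hw : Window μ a₁ δ η) {t : ℝ} (ht : t ≤ 1 - η) : profile μ a₁ f t = descent μ a₁ t := by
  have hη := hw.η_le
  have : ∫ s in (0 : ℝ)..t, Real.exp (μ * s) * (a₁ * f (descent μ a₁ (s - 1))) =
      ∫ s in (0 : ℝ)..t, (-a₁) * Real.exp (μ * s) := by
    apply intervalIntegral.integral_congr
    intro s hs
    have hs2 : s ≤ 1 - η := hs.2.trans (max_le (by linarith) ht)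
    simp only
    rw [hf.eq_neg_one hw.δ_pos (le_descent hμ ha₁ hw (by linarith))]
    ring
  rw [profile, this, intervalIntegral.integral_const_mul, integral_exp_mul hμ, descent]
  simp only [mul_zero, Real.exp_zero]
  linear_combination (-(a₁ / μ)) * exp_neg_mul_exp (μ * t)

/-- By the balance condition the window around time 1 contributes as much as for -sign. The formula,
and with it the second zero ω, is therefore independent of f. -/
lemma profile_eq_ascent (hf : IsSmoothFeedback μ a₁ δ f) (hμ : 0 < μ) (ha₁ : 0 < a₁)
    (hw : Window μ a₁ δ η) {t : ℝ} (ht : 1 + η ≤ t) :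
    Real.exp (μ * t) * profile μ a₁ f t = a₁ / μ * (Real.exp (μ * t) - zeroGapExp μ) := by
  have hη := hw.η_le
  have hη0 := hw.η_pos
  have hc : Continuous f := hf.smooth.continuous
  rw [exp_mul_profile_eq_add hc (1 + η), exp_mul_profile_eq_add hc (1 - η) (1 + η),
    profile_eq_descent hf hμ ha₁ hw le_rfl]
  have i1 : ∫ v in (1 + η)..t, Real.exp (μ * v) * (a₁ * f (descent μ a₁ (v - 1))) =
      ∫ v in (1 + η)..t, a₁ * Real.exp (μ * v) := by
    apply intervalIntegral.integral_congr
    intro s hs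
    rw [uIcc_of_le ht] at hs
    simp only
    rw [hf.eq_one hw.δ_pos (descent_le hμ ha₁ hw (by linarith [hs.1]))]
    ring
  have i2 : ∫ v in (1 - η)..(1 + η), Real.exp (μ * v) * (a₁ * f (descent μ a₁ (v - 1))) =
      a₁ * Real.exp μ * ((Real.exp (μ * η) + Real.exp (-(μ * η)) - 2) / μ) := by
    rw [← hf.integral_window hμ ha₁ hw, ← intervalIntegral.integral_const_mul]
    have hshift := intervalIntegral.integral_comp_sub_right (a := 1 - η) (b := 1 + η)
      (fun s => a₁ * Real.exp μ * (Real.exp (μ * s) * f (descent μ a₁ s))) 1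
    rw [show 1 - η - 1 = -η by ring, show 1 + η - 1 = η by ring] at hshift
    rw [← hshift]
    apply intervalIntegral.integral_congr
    intro s _
    simp only
    rw [show μ * s = μ + μ * (s - 1) by ring, Real.exp_add]
    ring
  rw [i1, i2, intervalIntegral.integral_const_mul, integral_exp_mul hμ, descent, zeroGapExp]
  rw [show μ * (1 + η) = μ + μ * η by ring, show μ * (1 - η) = μ + -(μ * η) by ring, Real.exp_add,
    Real.exp_add, neg_add, neg_neg, Real.exp_add, Real.exp_neg μ, Real.exp_neg (μ * η)]
  have h1 := (Real.exp_pos μ).ne'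
  have h2 := (Real.exp_pos (μ * η)).ne'
  field_simp
  ring

lemma le_profile_of_le (hf : IsSmoothFeedback μ a₁ δ f) (hμ : 0 < μ) (ha₁ : 0 < a₁)
    (hw : Window μ a₁ δ η) {t : ℝ} (ht : t ≤ -η) : δ ≤ profile μ a₁ f t := by
  have hη := hw.η_le
  rw [profile_eq_descent hf hμ ha₁ hw (by linarith)]
  exact le_descent hμ ha₁ hw ht

lemma le_profile_of_ge (hf : IsSmoothFeedback μ a₁ δ f) (hμ : 0 < μ) (ha₁ : 0 < a₁)
    (hw : Window μ a₁ δ η) {t : ℝ} (ht : zeroGap μ + η ≤ t) : δ ≤ profile μ a₁ f t := by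
  have h := profile_eq_ascent hf hμ ha₁ hw (t := t) (by linarith [one_lt_zeroGap hμ])
  have hE := Real.exp_pos (μ * t)
  refine le_of_mul_le_mul_left ?_ hE
  rw [h]
  have h1 := hw.le_one_sub_exp hμ (t := t - zeroGap μ) (by linarith)
  have h2 := Window.le_of_exp (δ := δ) hμ ha₁
    (z := 1 + (1 - Real.exp (-(μ * (t - zeroGap μ))))) (by linarith)
  have h3 : Real.exp (μ * t) * Real.exp (-(μ * (t - zeroGap μ))) = zeroGapExp μ := by
    rw [← Real.exp_add, ← exp_mul_zeroGap hμ]; congr 1; ring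
  calc Real.exp (μ * t) * δ ≤ Real.exp (μ * t) *
        (a₁ / μ * (1 + (1 - Real.exp (-(μ * (t - zeroGap μ)))) - 1)) := by gcongr
    _ = _ := by rw [← h3]; ring

/-- The ascent is strictly increasing towards a₁/μ. Strictness is what later gives the periodic
initial state a whole C⁰-neighbourhood of states above δ. -/
lemma lt_profile_of_gt (hf : IsSmoothFeedback μ a₁ δ f) (hμ : 0 < μ) (ha₁ : 0 < a₁)
    (hw : Window μ a₁ δ η) {t : ℝ} (ht : zeroGap μ + η < t) : δ < profile μ a₁ f t := by
  have hgap := one_lt_zeroGap hμ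
  have h1 := profile_eq_ascent hf hμ ha₁ hw (t := t) (by linarith)
  have h2 := profile_eq_ascent hf hμ ha₁ hw (t := zeroGap μ + η) (by linarith)
  have h3 := le_profile_of_ge hf hμ ha₁ hw (le_refl (zeroGap μ + η))
  have hE := Real.exp_pos (μ * (zeroGap μ + η))
  have hEt : Real.exp (μ * (zeroGap μ + η)) < Real.exp (μ * t) :=
    Real.exp_lt_exp.2 (mul_lt_mul_of_pos_left ht hμ)
  have hc : 0 < a₁ / μ * zeroGapExp μ := mul_pos (by positivity) (zeroGapExp_pos hμ)
  have h4 := mul_le_mul_of_nonneg_left h3 hE.le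
  -- The ascent stays strictly below its limit a₁/μ, yet is already at least δ at ω + η.
  have hαδ : 0 < a₁ / μ - δ := by
    by_contra! h
    nlinarith
  refine lt_of_mul_lt_mul_left ?_ (Real.exp_pos (μ * t)).le
  nlinarith

/-- Before and after the window around time 1 the explicit formulas apply. Inside it only f ≤ 1 is
used, and the field `small` of `Window` says that even the fastest possible rise stays below -δ. -/
lemma profile_le (hf : IsSmoothFeedback μ a₁ δ f) (hμ : 0 < μ) (ha₁ : 0 < a₁)
    (hw : Window μ a₁ δ η) {t : ℝ} (h1 : η ≤ t) (h2 : t ≤ zeroGap μ - η) :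
    profile μ a₁ f t ≤ -δ := by
  have hη := hw.η_pos
  have hc : Continuous f := hf.smooth.continuous
  rcases le_total t (1 - η) with h | h
  · rw [profile_eq_descent hf hμ ha₁ hw h]
    exact descent_le hμ ha₁ hw h1
  have hE := Real.exp_pos (μ * t)
  have key : ∀ z : ℝ, Real.exp (μ * t) * profile μ a₁ f t ≤ a₁ / μ * (Real.exp (μ * t) - z) →
      (1 + μ * δ / a₁) * Real.exp (μ * t) ≤ z → profile μ a₁ f t ≤ -δ := by
    intro z hz1 hz2
    refine le_of_mul_le_mul_left (hz1.trans ?_) hE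
    have : a₁ / μ * (Real.exp (μ * t) - z) ≤ a₁ / μ * (-(μ * δ / a₁) * Real.exp (μ * t)) :=
      mul_le_mul_of_nonneg_left (by linarith) (by positivity)
    refine this.trans (le_of_eq ?_)
    field_simp
  rcases le_total t (1 + η) with h' | h'
  -- This constant belongs to the comparison solution that has feedback 1 from time 1 - η on.
  · apply key (2 * Real.exp (μ * (1 - η)) - 1)
    · rw [exp_mul_profile_eq_add hc (1 - η), profile_eq_descent hf hμ ha₁ hw le_rfl]
      have : ∫ v in (1 - η)..t, Real.exp (μ * v) * (a₁ * f (descent μ a₁ (v - 1))) ≤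
          ∫ v in (1 - η)..t, a₁ * Real.exp (μ * v) := by
        apply intervalIntegral.integral_mono_on h
          ((continuous_profile_integrand hc).intervalIntegrable _ _)
          (Continuous.intervalIntegrable (by fun_prop) _ _)
        intro v _
        have hv := (abs_le.1 (hf.abs_le_one hw.δ_pos (descent μ a₁ (v - 1)))).2
        have hm : 0 ≤ a₁ * Real.exp (μ * v) := by positivity
        nlinarith
      rw [intervalIntegral.integral_const_mul, integral_exp_mul hμ] at this
      rw [descent]
      have h3 := exp_neg_mul_exp (μ * (1 - η))
      have h4 : Real.exp (μ * (1 - η)) * (a₁ / μ * (Real.exp (-(μ * (1 - η))) - 1)) =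
          a₁ / μ * (1 - Real.exp (μ * (1 - η))) := by linear_combination (a₁ / μ) * h3
      rw [h4]
      refine (add_le_add_right this _).trans (le_of_eq ?_)
      ring
    · have h3 : (1 + μ * δ / a₁) * Real.exp (μ * t) ≤ Real.exp (μ * η) * Real.exp (μ * (1 + η)) := by
        have := hw.one_add_width_le
        gcongr
      rw [← Real.exp_add, show μ * η + μ * (1 + η) = μ * (1 + 2 * η) by ring] at h3
      linarith [hw.small]
  · apply key (zeroGapExp μ) (profile_eq_ascent hf hμ ha₁ hw h').le
    rw [← exp_mul_zeroGap hμ]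
    have := hw.one_add_le_exp hμ (t := zeroGap μ - t) (by linarith)
    calc (1 + μ * δ / a₁) * Real.exp (μ * t) ≤ Real.exp (μ * (zeroGap μ - t)) * Real.exp (μ * t) := by
          gcongr
      _ = _ := by rw [← Real.exp_add]; congr 1; ring

/-- Self-consistency: the profile was defined with `descent` as delayed input, and until shortly
before ω the feedback cannot distinguish the two. -/
lemma feedback_profile_eq (hf : IsSmoothFeedback μ a₁ δ f) (hμ : 0 < μ) (ha₁ : 0 < a₁)
    (hw : Window μ a₁ δ η) {t : ℝ} (ht : t ≤ zeroGap μ - η) :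
    f (profile μ a₁ f t) = f (descent μ a₁ t) := by
  rcases le_total t (1 - η) with h | h
  · rw [profile_eq_descent hf hμ ha₁ hw h]
  · have h1 : η ≤ t := by linarith [hw.η_le]
    rw [hf.eq_one hw.δ_pos (profile_le hf hμ ha₁ hw h1 ht),
      hf.eq_one hw.δ_pos (descent_le hμ ha₁ hw h1)]

end Profile

end DelayEq

namespace DelayEq

/-! ### The solution on one period -/

/-- The candidate for the solution on `[0,T]` with first zero `θ`: the delayed term is read off from
the profile, translated by `θ`. -/
noncomputable def branch (μ a₁ : ℝ) (a f : ℝ → ℝ) (θ t : ℝ) : ℝ :=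
  Real.exp (-(μ * t)) * (a₁ / μ * (Real.exp (μ * θ) - 1) +
    ∫ v in (0 : ℝ)..t, Real.exp (μ * v) * (a v * f (profile μ a₁ f (v - 1 - θ))))

/-- Inequalities which guarantee that the solution with first zero `θ` has the expected shape. -/
structure Margins (μ a₁ a₂ p₁ p₂ δ η ρ θ : ℝ) : Prop where
  start : ρ ≤ θ - η
  switch_lower : zeroGap μ + η ≤ p₁ - θ
  switch_upper : p₁ + ρ - 1 - θ ≤ zeroGap μ - η
  finish : zeroGap μ + η < p₁ + p₂ - 1 - θ
  slope : μ * δ ≤ a₂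
  initial : δ * Real.exp (μ * ρ) + 2 * max a₁ a₂ * (ρ * Real.exp (μ * ρ)) ≤
    a₁ / μ * (Real.exp (μ * θ) - 1)
  rise : δ * Real.exp (μ * (p₁ + ρ)) <
    a₁ / μ * (Real.exp (μ * p₁) - zeroGapExp μ * Real.exp (μ * θ))
  final : (δ + a₂ / μ) * Real.exp (μ * (p₁ + p₂)) <
    a₁ / μ * (Real.exp (μ * p₁) - zeroGapExp μ * Real.exp (μ * θ)) -
      a₂ / μ * Real.exp (μ * p₁) + 2 * (a₂ / μ) * Real.exp (μ * (1 + θ + zeroGap μ - η))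

/-- The error caused by the smoothing of the feedback at the second zero. -/
noncomputable def defect (μ a₁ : ℝ) (f : ℝ → ℝ) (η : ℝ) : ℝ :=
  (∫ v in (zeroGap μ - η)..(zeroGap μ + η), Real.exp (μ * v) * f (profile μ a₁ f v)) +
    (Real.exp (μ * (zeroGap μ - η)) + Real.exp (μ * (zeroGap μ + η)) - 2 * zeroGapExp μ) / μ

section Branch

variable {μ a₁ a₂ p₁ p₂ δ η ρ θ : ℝ} {a f : ℝ → ℝ}

lemma integral_mul_exp_of_weighted {p q c : ℝ}
    (h : ∫ s in p..q, a s * Real.exp (-μ * (q - s)) = ∫ s in p..q, c * Real.exp (-μ * (q - s))) :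
    ∫ s in p..q, Real.exp (μ * s) * a s = ∫ s in p..q, c * Real.exp (μ * s) := by
  have e : ∀ s, Real.exp (-μ * (q - s)) = Real.exp (-(μ * q)) * Real.exp (μ * s) := fun s => by
    rw [← Real.exp_add]; congr 1; ring
  have h1 : ∀ b : ℝ → ℝ, ∫ s in p..q, b s * Real.exp (-μ * (q - s)) =
      Real.exp (-(μ * q)) * ∫ s in p..q, Real.exp (μ * s) * b s := fun b => by
    rw [← intervalIntegral.integral_const_mul]
    congr 1; ext s; rw [e]; ring
  rw [h1, h1 (fun _ => c)] at h
  rw [mul_left_cancel₀ (Real.exp_pos _).ne' h]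
  congr 1; ext s; ring

lemma exp_mul_branch (t : ℝ) : Real.exp (μ * t) * branch μ a₁ a f θ t =
    a₁ / μ * (Real.exp (μ * θ) - 1) +
      ∫ v in (0 : ℝ)..t, Real.exp (μ * v) * (a v * f (profile μ a₁ f (v - 1 - θ))) := by
  rw [branch, ← mul_assoc, mul_comm (Real.exp (μ * t)), exp_neg_mul_exp, one_mul]

lemma continuous_branch_integrand (ha : Continuous a) (hf : Continuous f) :
    Continuous fun v => Real.exp (μ * v) * (a v * f (profile μ a₁ f (v - 1 - θ))) := by
  have := continuous_profile (μ := μ) (a₁ := a₁) hf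
  fun_prop

lemma exp_mul_branch_eq_add (ha : Continuous a) (hf : Continuous f) (s t : ℝ) :
    Real.exp (μ * t) * branch μ a₁ a f θ t = Real.exp (μ * s) * branch μ a₁ a f θ s +
      ∫ v in s..t, Real.exp (μ * v) * (a v * f (profile μ a₁ f (v - 1 - θ))) := by
  rw [exp_mul_branch, exp_mul_branch, add_assoc,
    intervalIntegral.integral_add_adjacent_intervals] <;>
  exact (continuous_branch_integrand ha hf).intervalIntegrable _ _

variable (hμ : 0 < μ) (ha₁ : 0 < a₁) (ha₂ : 0 < a₂) (hρ : 0 < ρ)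
  (hf : IsSmoothFeedback μ a₁ δ f) (ha : IsSmoothCoefficient μ a₁ a₂ p₁ p₂ ρ a)
  (hw : Window μ a₁ δ η) (hm : Margins μ a₁ a₂ p₁ p₂ δ η ρ θ)

include hw hm in
lemma Margins.ρ_lt_one : ρ < 1 := by
  linarith [hm.switch_lower, hm.switch_upper, hw.η_pos]

include ha₁ ha₂ ha in
lemma IsSmoothCoefficient.pos {t : ℝ} (ht : t ∈ Icc 0 (p₁ + p₂)) : 0 < a t := by
  rcases le_total t ρ with h | h
  · exact (ha.bound_first t ⟨ht.1, h⟩).1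
  rcases le_total t p₁ with h1 | h1
  · rw [ha.eq_first t ⟨h, h1⟩]; exact ha₁
  rcases le_total t (p₁ + ρ) with h2 | h2
  · exact (ha.bound_second t ⟨h1, h2⟩).1
  · rw [ha.eq_second t ⟨h2, ht.2⟩]; exact ha₂

include hμ ha₁ hf hw hm in
lemma feedback_profile_early (hρ : 0 < ρ) {v : ℝ} (hv : v ≤ 0) :
    f (profile μ a₁ f (v - θ)) = -1 :=
  hf.eq_neg_one hw.δ_pos (le_profile_of_le hf hμ ha₁ hw (by linarith [hm.start]))

include hμ ha₁ hf hw hm in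
-- The delayed argument lies in the negative phase. By the margin `switch_upper` this covers the
-- whole transition of the coefficient after p₁, so that only its weighted integral matters there.
lemma feedback_profile_middle {v : ℝ} (h1 : p₁ ≤ v) (h2 : v ≤ 1 + θ + zeroGap μ - η) :
    f (profile μ a₁ f (v - 1 - θ)) = 1 :=
  hf.eq_one hw.δ_pos (profile_le hf hμ ha₁ hw
    (by linarith [hm.switch_lower, one_lt_zeroGap hμ]) (by linarith))

include hμ ha₁ hf hw hm hρ in
lemma exp_mul_branch_first {t : ℝ} (h0 : 0 ≤ t) (h1 : t ≤ 1) :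
    Real.exp (μ * t) * branch μ a₁ a f θ t = a₁ / μ * (Real.exp (μ * θ) - 1) -
      ∫ v in (0 : ℝ)..t, Real.exp (μ * v) * a v := by
  rw [exp_mul_branch, sub_eq_add_neg (a₁ / μ * _), ← intervalIntegral.integral_neg]
  congr 1
  apply intervalIntegral.integral_congr
  intro v hv
  rw [uIcc_of_le h0] at hv
  simp only
  rw [feedback_profile_early hμ ha₁ hf hw hm hρ (by linarith [hv.2])]
  ring

include hμ ha₁ hf ha hw hm hρ in
-- During the first transition only the bound 2 max(a₁,a₂) for the coefficient is available; the
-- margin `initial` is made for this crude estimate.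
lemma le_branch_first {t : ℝ} (h0 : 0 ≤ t) (h1 : t ≤ ρ) : δ ≤ branch μ a₁ a f θ t := by
  have hρ1 := hm.ρ_lt_one hw
  have hac := ha.smooth.continuous
  refine le_of_mul_le_mul_left ?_ (Real.exp_pos (μ * t))
  rw [exp_mul_branch_first hμ ha₁ hρ hf hw hm h0 (by linarith)]
  have hE : ∀ v, v ≤ ρ → Real.exp (μ * v) ≤ Real.exp (μ * ρ) := fun v hv =>
    Real.exp_le_exp.2 (mul_le_mul_of_nonneg_left hv hμ.le)
  have hmax : 0 < max a₁ a₂ := lt_max_of_lt_left ha₁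
  have hb : ∫ v in (0 : ℝ)..t, Real.exp (μ * v) * a v ≤
      ∫ v in (0 : ℝ)..t, Real.exp (μ * ρ) * (2 * max a₁ a₂) := by
    apply intervalIntegral.integral_mono_on h0 (Continuous.intervalIntegrable (by fun_prop) _ _)
      (Continuous.intervalIntegrable (by fun_prop) _ _)
    intro v hv
    obtain ⟨h3, h4⟩ := ha.bound_first v ⟨hv.1, hv.2.trans h1⟩
    have := hE v (hv.2.trans h1)
    gcongr
  rw [intervalIntegral.integral_const, smul_eq_mul, sub_zero] at hb
  have h5 : t * (Real.exp (μ * ρ) * (2 * max a₁ a₂)) ≤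
      ρ * (Real.exp (μ * ρ) * (2 * max a₁ a₂)) := by gcongr
  have h6 : Real.exp (μ * t) * δ ≤ Real.exp (μ * ρ) * δ :=
    mul_le_mul_of_nonneg_right (hE t h1) hw.δ_pos.le
  linarith [hm.initial]

include hμ ha₁ hf ha hw hm hρ in
-- The weighted condition puts the branch at time ρ on the descent through θ. From there on both
-- functions satisfy the same integral equation, up to translation by θ.
lemma branch_eq_profile {t : ℝ} (h0 : ρ ≤ t) (h1 : t ≤ p₁) :
    branch μ a₁ a f θ t = profile μ a₁ f (t - θ) := by
  have hfc := hf.smooth.continuous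
  have hρ1 := hm.ρ_lt_one hw
  have hη := hw.η_pos
  refine mul_left_cancel₀ (Real.exp_pos (μ * t)).ne' ?_
  have hEθ : ∀ s, Real.exp (μ * s) = Real.exp (μ * θ) * Real.exp (μ * (s - θ)) := fun s => by
    rw [← Real.exp_add]; congr 1; ring
  have hstart : Real.exp (μ * ρ) * branch μ a₁ a f θ ρ =
      Real.exp (μ * ρ) * profile μ a₁ f (ρ - θ) := by
    rw [exp_mul_branch_first hμ ha₁ hρ hf hw hm hρ.le hρ1.le,
      integral_mul_exp_of_weighted ha.weighted_first, intervalIntegral.integral_const_mul,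
      integral_exp_mul hμ, profile_eq_descent hf hμ ha₁ hw
        (by linarith [hm.start, hw.η_le]), descent, mul_zero, Real.exp_zero,
      show -(μ * (ρ - θ)) = μ * θ + -(μ * ρ) by ring, Real.exp_add]
    linear_combination (-(a₁ / μ) * Real.exp (μ * θ)) * exp_neg_mul_exp (μ * ρ)
  rw [exp_mul_branch_eq_add ha.smooth.continuous hfc ρ t, hstart]
  have hp : Real.exp (μ * t) * profile μ a₁ f (t - θ) =
      Real.exp (μ * ρ) * profile μ a₁ f (ρ - θ) +
        Real.exp (μ * θ) * ∫ v in (ρ - θ)..(t - θ),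
          Real.exp (μ * v) * (a₁ * f (descent μ a₁ (v - 1))) := by
    rw [hEθ t, hEθ ρ, mul_assoc, exp_mul_profile_eq_add hfc (ρ - θ) (t - θ)]
    ring
  rw [hp, ← intervalIntegral.integral_comp_sub_right
    (fun v => Real.exp (μ * v) * (a₁ * f (descent μ a₁ (v - 1)))) θ,
    ← intervalIntegral.integral_const_mul]
  congr 1
  apply intervalIntegral.integral_congr
  intro v hv
  rw [uIcc_of_le h0] at hv
  simp only
  rw [ha.eq_first v ⟨hv.1, hv.2.trans h1⟩, feedback_profile_eq hf hμ ha₁ hw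
    (by linarith [hm.switch_upper, hv.2]), ← mul_assoc (Real.exp (μ * θ)), ← hEθ,
    show v - 1 - θ = v - θ - 1 by ring]

include hμ ha₁ hf ha hw hm hρ in
lemma exp_mul_branch_switch : Real.exp (μ * p₁) * branch μ a₁ a f θ p₁ =
    a₁ / μ * (Real.exp (μ * p₁) - zeroGapExp μ * Real.exp (μ * θ)) := by
  have hE : Real.exp (μ * p₁) = Real.exp (μ * θ) * Real.exp (μ * (p₁ - θ)) := by
    rw [← Real.exp_add]; congr 1; ring
  have h1 := one_lt_zeroGap hμ
  have h2 := hm.switch_lower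
  have h3 := hm.start
  have h4 := hw.η_pos
  rw [branch_eq_profile hμ ha₁ hρ hf ha hw hm (by linarith) le_rfl, hE, mul_assoc,
    profile_eq_ascent hf hμ ha₁ hw (by linarith)]
  ring

include hμ ha₁ hf ha hw hm hρ in
lemma exp_mul_branch_second {t : ℝ} (h1 : p₁ + ρ ≤ t) (h2 : t ≤ p₁ + p₂) :
    Real.exp (μ * t) * branch μ a₁ a f θ t =
      a₁ / μ * (Real.exp (μ * p₁) - zeroGapExp μ * Real.exp (μ * θ)) +
        a₂ * ∫ v in p₁..t, Real.exp (μ * v) * f (profile μ a₁ f (v - 1 - θ)) := by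
  have hfc := hf.smooth.continuous
  have hac := ha.smooth.continuous
  have hpc := continuous_profile (μ := μ) (a₁ := a₁) hfc
  have hi : ∀ p q, IntervalIntegrable (fun v => Real.exp (μ * v) * f (profile μ a₁ f (v - 1 - θ)))
      MeasureTheory.volume p q := fun p q => Continuous.intervalIntegrable (by fun_prop) _ _
  have hj : ∀ p q, IntervalIntegrable
      (fun v => Real.exp (μ * v) * (a v * f (profile μ a₁ f (v - 1 - θ))))
      MeasureTheory.volume p q := fun p q => Continuous.intervalIntegrable (by fun_prop) _ _
  rw [exp_mul_branch_eq_add hac hfc p₁ t, exp_mul_branch_switch hμ ha₁ hρ hf ha hw hm,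
    ← intervalIntegral.integral_add_adjacent_intervals (hi p₁ (p₁ + ρ)) (hi _ t),
    ← intervalIntegral.integral_add_adjacent_intervals (hj p₁ (p₁ + ρ)) (hj _ t), mul_add]
  congr 2
  · have hmid : ∀ v ∈ uIcc p₁ (p₁ + ρ), f (profile μ a₁ f (v - 1 - θ)) = 1 := fun v hv => by
      rw [uIcc_of_le (by linarith)] at hv
      exact feedback_profile_middle hμ ha₁ hf hw hm hv.1 (by linarith [hv.2, hm.switch_upper])
    rw [← intervalIntegral.integral_const_mul]
    calc _ = ∫ v in p₁..(p₁ + ρ), Real.exp (μ * v) * a v := by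
          apply intervalIntegral.integral_congr
          intro v hv
          simp only
          rw [hmid v hv, mul_one]
      _ = ∫ v in p₁..(p₁ + ρ), a₂ * Real.exp (μ * v) :=
          integral_mul_exp_of_weighted ha.weighted_second
      _ = _ := by
          apply intervalIntegral.integral_congr
          intro v hv
          simp only
          rw [hmid v hv, mul_one]
  · rw [← intervalIntegral.integral_const_mul]
    apply intervalIntegral.integral_congr
    intro v hv
    rw [uIcc_of_le h1] at hv
    simp only
    rw [ha.eq_second v ⟨hv.1, hv.2.trans h2⟩]
    ring

include hμ ha₁ ha₂ hf ha hw hm hρ in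
-- Until the delayed second crossing the feedback is 1 and the margin `rise` suffices. Afterwards
-- the branch is compared with the solution having feedback -1, whose smallest value over the rest
-- of the period is controlled by `final`.
lemma lt_branch_second {t : ℝ} (h1 : p₁ ≤ t) (h2 : t ≤ p₁ + p₂) : δ < branch μ a₁ a f θ t := by
  have hfc := hf.smooth.continuous
  have hac := ha.smooth.continuous
  have hpc := continuous_profile (μ := μ) (a₁ := a₁) hfc
  have hδ := hw.δ_pos
  have hgap := one_lt_zeroGap hμ
  have hη := hw.η_pos
  have hp₁ : 0 ≤ p₁ := by linarith [hm.start, hm.switch_lower]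
  have hα₂ : δ ≤ a₂ / μ := by rw [le_div_iff₀ hμ]; linarith [hm.slope]
  have hE : ∀ s t, s ≤ t → Real.exp (μ * s) ≤ Real.exp (μ * t) := fun s t h =>
    Real.exp_le_exp.2 (mul_le_mul_of_nonneg_left h hμ.le)
  refine lt_of_mul_lt_mul_left ?_ (Real.exp_pos (μ * t)).le
  rcases le_total t (p₁ + ρ) with h3 | h3
  · rw [exp_mul_branch_eq_add hac hfc p₁ t, exp_mul_branch_switch hμ ha₁ hρ hf ha hw hm]
    have : 0 ≤ ∫ v in p₁..t, Real.exp (μ * v) * (a v * f (profile μ a₁ f (v - 1 - θ))) := by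
      apply intervalIntegral.integral_nonneg h1
      intro v hv
      rw [feedback_profile_middle hμ ha₁ hf hw hm hv.1 (by linarith [hv.2, hm.switch_upper])]
      have := ha.pos ha₁ ha₂ (t := v) ⟨hp₁.trans hv.1, hv.2.trans h2⟩
      positivity
    have h4 : Real.exp (μ * t) * δ ≤ Real.exp (μ * (p₁ + ρ)) * δ :=
      mul_le_mul_of_nonneg_right (hE _ _ h3) hδ.le
    linarith [hm.rise]
  rw [exp_mul_branch_second hμ ha₁ hρ hf ha hw hm h3 h2]
  have hup : ∀ s, p₁ ≤ s → s ≤ 1 + θ + zeroGap μ - η →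
      ∫ v in p₁..s, Real.exp (μ * v) * f (profile μ a₁ f (v - 1 - θ)) =
        (Real.exp (μ * s) - Real.exp (μ * p₁)) / μ := by
    intro s hs1 hs2
    rw [← integral_exp_mul hμ]
    apply intervalIntegral.integral_congr
    intro v hv
    rw [uIcc_of_le hs1] at hv
    simp only
    rw [feedback_profile_middle hμ ha₁ hf hw hm hv.1 (hv.2.trans hs2), mul_one]
  rcases le_total t (1 + θ + zeroGap μ - η) with h4 | h4
  · rw [hup t h1 h4]
    have h5 : (a₂ / μ - δ) * Real.exp (μ * p₁) ≤ (a₂ / μ - δ) * Real.exp (μ * t) :=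
      mul_le_mul_of_nonneg_left (hE _ _ h1) (by linarith)
    have h6 : Real.exp (μ * p₁) * δ ≤ Real.exp (μ * (p₁ + ρ)) * δ :=
      mul_le_mul_of_nonneg_right (hE _ _ (by linarith)) hδ.le
    have h7 : a₂ * ((Real.exp (μ * t) - Real.exp (μ * p₁)) / μ) =
      a₂ / μ * Real.exp (μ * t) - a₂ / μ * Real.exp (μ * p₁) := by ring
    linarith [hm.rise]
  · set τ := 1 + θ + zeroGap μ - η with hτ
    have hpτ : p₁ ≤ τ := by linarith [hm.switch_upper]
    have hi : ∀ p q, IntervalIntegrable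
      (fun v => Real.exp (μ * v) * f (profile μ a₁ f (v - 1 - θ))) MeasureTheory.volume p q :=
      fun p q => Continuous.intervalIntegrable (by fun_prop) _ _
    rw [← intervalIntegral.integral_add_adjacent_intervals (hi p₁ τ) (hi τ t), hup τ hpτ le_rfl]
    -- From τ on, including the window where f is unknown, only f ≥ -1 is used.
    have h5 : ∫ v in τ..t, -Real.exp (μ * v) ≤
        ∫ v in τ..t, Real.exp (μ * v) * f (profile μ a₁ f (v - 1 - θ)) := by
      apply intervalIntegral.integral_mono_on h4
        (Continuous.intervalIntegrable (by fun_prop) _ _) (hi _ _)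
      intro v _
      have := (abs_le.1 (hf.abs_le_one hδ (profile μ a₁ f (v - 1 - θ)))).1
      nlinarith [Real.exp_pos (μ * v)]
    rw [intervalIntegral.integral_neg, integral_exp_mul hμ] at h5
    have h6 := mul_le_mul_of_nonneg_left h5 ha₂.le
    have h7 : (δ + a₂ / μ) * Real.exp (μ * t) ≤ (δ + a₂ / μ) * Real.exp (μ * (p₁ + p₂)) :=
      mul_le_mul_of_nonneg_left (hE _ _ h2) (by positivity)
    have h8 : a₂ * ((Real.exp (μ * τ) - Real.exp (μ * p₁)) / μ +
        ∫ v in τ..t, Real.exp (μ * v) * f (profile μ a₁ f (v - 1 - θ))) ≥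
        2 * (a₂ / μ) * Real.exp (μ * τ) - a₂ / μ * Real.exp (μ * p₁) -
          a₂ / μ * Real.exp (μ * t) := by
      rw [mul_add]
      have : a₂ * ((Real.exp (μ * τ) - Real.exp (μ * p₁)) / μ) +
        a₂ * (-((Real.exp (μ * t) - Real.exp (μ * τ)) / μ)) = 2 * (a₂ / μ) * Real.exp (μ * τ) -
          a₂ / μ * Real.exp (μ * p₁) - a₂ / μ * Real.exp (μ * t) := by ring
      linarith
    linarith [hm.final]

include hμ ha₁ ha₂ hf ha hw hm hρ in
lemma lt_branch_last {t : ℝ} (h1 : p₁ + p₂ - 1 ≤ t) (h2 : t ≤ p₁ + p₂) :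
    δ < branch μ a₁ a f θ t := by
  have hfi := hm.finish
  rcases le_total t p₁ with h3 | h3
  · rw [branch_eq_profile hμ ha₁ hρ hf ha hw hm
      (by linarith [one_lt_zeroGap hμ, hw.η_pos, hm.start]) h3]
    exact lt_profile_of_gt hf hμ ha₁ hw (by linarith)
  · exact lt_branch_second hμ ha₁ ha₂ hρ hf ha hw hm h3 h2

include hμ ha₁ ha₂ hf ha hw hm hρ in
-- This closes the loop: the branch takes its delayed input from the profile, and the feedback sees
-- no difference at any delayed time in [0,T-1].
lemma feedback_branch_eq {t : ℝ} (h0 : 0 ≤ t) (h1 : t ≤ p₁ + p₂ - 1) :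
    f (branch μ a₁ a f θ t) = f (profile μ a₁ f (t - θ)) := by
  have hδ := hw.δ_pos
  rcases le_total t ρ with h2 | h2
  · rw [hf.eq_neg_one hδ (le_branch_first hμ ha₁ hρ hf ha hw hm h0 h2),
      hf.eq_neg_one hδ (le_profile_of_le hf hμ ha₁ hw (by linarith [hm.start]))]
  rcases le_total t p₁ with h3 | h3
  · rw [branch_eq_profile hμ ha₁ hρ hf ha hw hm h2 h3]
  · rw [hf.eq_neg_one hδ (lt_branch_second hμ ha₁ ha₂ hρ hf ha hw hm h3 (by linarith)).le,
      hf.eq_neg_one hδ (le_profile_of_ge hf hμ ha₁ hw (by linarith [hm.switch_lower]))]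

include hμ ha₁ ha₂ hf ha hw hm hρ in
/-- Every solution which starts above `δ` agrees with the branch on one period. -/
lemma IsSolutionFrom.eq_branch {φ : C0} {x : ℝ → ℝ} (hx : IsSolutionFrom μ a f 0 φ x)
    (hφ : ∀ s, δ ≤ φ s) (h0 : ev0 φ = a₁ / μ * (Real.exp (μ * θ) - 1)) {t : ℝ} (ht0 : 0 ≤ t)
    (ht1 : t ≤ p₁ + p₂) : x t = branch μ a₁ a f θ t := by
  have hfc := hf.smooth.continuous
  have hac := ha.smooth.continuous
  have hx0 : x 0 = ev0 φ := hx.apply_start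
  have key : ∀ s, 0 ≤ s → (∀ v ∈ Icc 0 s, f (x (v - 1)) = f (profile μ a₁ f (v - 1 - θ))) →
      x s = branch μ a₁ a f θ s := by
    intro s hs h
    refine mul_left_cancel₀ (Real.exp_pos (μ * s)).ne' ?_
    rw [hx.integral_eq hac hfc le_rfl hs, exp_mul_branch, hx0, h0, mul_zero, Real.exp_zero, one_mul]
    congr 1
    apply intervalIntegral.integral_congr
    intro v hv
    rw [uIcc_of_le hs] at hv
    simp only
    rw [h v hv]
  -- Method of steps: agreement of the feedback values up to time n gives agreement of the functions
  -- there, and hence of the feedback values one unit later.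
  have hall : ∀ n : ℕ, ∀ v : ℝ, 0 ≤ v → v ≤ n → v ≤ p₁ + p₂ →
      f (x (v - 1)) = f (profile μ a₁ f (v - 1 - θ)) := by
    have hinit : ∀ v, 0 ≤ v → v ≤ 1 → f (x (v - 1)) = f (profile μ a₁ f (v - 1 - θ)) := by
      intro v hv0 hv1
      have hi := hx.initial ⟨v - 1, by linarith, by linarith⟩
      simp only [zero_add] at hi
      rw [hi, hf.eq_neg_one hw.δ_pos (hφ _),
        feedback_profile_early hμ ha₁ hf hw hm hρ (by linarith)]
    intro n
    induction n with
    | zero => intro v hv0 hv1 _; exact hinit v hv0 (by push_cast at hv1; linarith)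
    | succ n ih =>
      intro v hv0 hv1 hv2
      rcases le_total v 1 with h | h
      · exact hinit v hv0 h
      push_cast at hv1
      rw [key (v - 1) (by linarith) (fun u hu => ih u hu.1 (by linarith [hu.2])
        (by linarith [hu.2]))]
      exact feedback_branch_eq hμ ha₁ ha₂ hρ hf ha hw hm (by linarith) (by linarith)
  obtain ⟨n, hn⟩ := exists_nat_ge t
  exact key t ht0 fun v hv => hall n v hv.1 (hv.2.trans hn) (hv.2.trans ht1)

include hμ ha₁ hf ha hw hm hρ in
/-- The value after one period is an affine function of `exp (μ θ)`. -/
lemma exp_mul_branch_period : Real.exp (μ * (p₁ + p₂)) * branch μ a₁ a f θ (p₁ + p₂) =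
    Real.exp (μ * θ) * (-(a₁ / μ * zeroGapExp μ) + 2 * (a₂ / μ) * zeroGapExp μ * Real.exp μ +
      a₂ * Real.exp μ * defect μ a₁ f η) + (a₁ - a₂) / μ * Real.exp (μ * p₁) -
        a₂ / μ * Real.exp (μ * (p₁ + p₂)) := by
  have hfc := hf.smooth.continuous
  have hpc := continuous_profile (μ := μ) (a₁ := a₁) hfc
  have hη := hw.η_pos
  have hgap := one_lt_zeroGap hμ
  have hsl := hm.switch_lower
  have hsu := hm.switch_upper
  have hfi := hm.finish
  have hi : ∀ p q, IntervalIntegrable (fun v => Real.exp (μ * v) * f (profile μ a₁ f v))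
      MeasureTheory.volume p q := fun p q => Continuous.intervalIntegrable (by fun_prop) _ _
  -- In time relative to 1 + θ the contribution of the second crossing no longer depends on θ; the
  -- factor exp(μ(1+θ)) pulled out is why the result is affine in exp(μθ).
  have h1 : ∫ v in p₁..(p₁ + p₂), Real.exp (μ * v) * f (profile μ a₁ f (v - 1 - θ)) =
      Real.exp (μ * (1 + θ)) * ∫ v in (p₁ - (1 + θ))..(p₁ + p₂ - (1 + θ)),
        Real.exp (μ * v) * f (profile μ a₁ f v) := by
    rw [← intervalIntegral.integral_comp_sub_right
      (fun v => Real.exp (μ * v) * f (profile μ a₁ f v)) (1 + θ),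
      ← intervalIntegral.integral_const_mul]
    congr 1; ext v
    rw [← mul_assoc, ← Real.exp_add, show v - (1 + θ) = v - 1 - θ by ring]
    congr 2; ring
  have h2 : ∫ v in (p₁ - (1 + θ))..(zeroGap μ - η), Real.exp (μ * v) * f (profile μ a₁ f v) =
      (Real.exp (μ * (zeroGap μ - η)) - Real.exp (μ * (p₁ - (1 + θ)))) / μ := by
    rw [← integral_exp_mul hμ]
    apply intervalIntegral.integral_congr
    intro v hv
    rw [uIcc_of_le (by linarith)] at hv
    simp only
    rw [hf.eq_one hw.δ_pos (profile_le hf hμ ha₁ hw (by linarith [hv.1]) hv.2), mul_one]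
  have h3 : ∫ v in (zeroGap μ + η)..(p₁ + p₂ - (1 + θ)),
      Real.exp (μ * v) * f (profile μ a₁ f v) =
      -((Real.exp (μ * (p₁ + p₂ - (1 + θ))) - Real.exp (μ * (zeroGap μ + η))) / μ) := by
    rw [← integral_exp_mul hμ, ← intervalIntegral.integral_neg]
    apply intervalIntegral.integral_congr
    intro v hv
    rw [uIcc_of_le (by linarith)] at hv
    simp only
    rw [hf.eq_neg_one hw.δ_pos (le_profile_of_ge hf hμ ha₁ hw hv.1), mul_neg_one]
  rw [exp_mul_branch_second hμ ha₁ hρ hf ha hw hm (by linarith) le_rfl, h1,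
    ← intervalIntegral.integral_add_adjacent_intervals (hi _ (zeroGap μ + η)) (hi _ _),
    ← intervalIntegral.integral_add_adjacent_intervals (hi _ (zeroGap μ - η)) (hi _ _), h2, h3,
    defect]
  have e1 : Real.exp (μ * (p₁ - (1 + θ))) =
      Real.exp (μ * p₁) * (Real.exp (μ * (1 + θ)))⁻¹ := by
    rw [← Real.exp_neg, ← Real.exp_add]; congr 1; ring
  have e2 : Real.exp (μ * (p₁ + p₂ - (1 + θ))) =
      Real.exp (μ * (p₁ + p₂)) * (Real.exp (μ * (1 + θ)))⁻¹ := by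
    rw [← Real.exp_neg, ← Real.exp_add]; congr 1; ring
  have e3 : Real.exp (μ * (1 + θ)) = Real.exp μ * Real.exp (μ * θ) := by
    rw [← Real.exp_add]; congr 1; ring
  rw [e1, e2, e3]
  have := (Real.exp_pos μ).ne'
  have := (Real.exp_pos (μ * θ)).ne'
  field_simp
  ring

end Branch

/-! ### Smallness of the error at the second zero -/

section Defect

variable {μ a₁ δ η : ℝ} {f : ℝ → ℝ}

/-- Only |f| ≤ 1 and the window length 2η are used, so the bound is uniform over all smoothings
compatible with η. -/
lemma abs_defect_le (hμ : 0 < μ) (hf : IsSmoothFeedback μ a₁ δ f) (hw : Window μ a₁ δ η) :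
    |defect μ a₁ f η| ≤ 2 * η * Real.exp (μ * (zeroGap μ + η)) +
      |(Real.exp (μ * (zeroGap μ - η)) + Real.exp (μ * (zeroGap μ + η)) - 2 * zeroGapExp μ) / μ| := by
  refine (abs_add_le _ _).trans (add_le_add_left ?_ _)
  have hη := hw.η_pos
  have := intervalIntegral.norm_integral_le_of_norm_le_const (a := zeroGap μ - η)
    (b := zeroGap μ + η) (C := Real.exp (μ * (zeroGap μ + η)))
    (f := fun v => Real.exp (μ * v) * f (profile μ a₁ f v)) (fun v hv => by
      rw [uIoc_of_le (by linarith)] at hv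
      rw [norm_mul, Real.norm_eq_abs, Real.norm_eq_abs, Real.abs_exp]
      have h1 : Real.exp (μ * v) ≤ Real.exp (μ * (zeroGap μ + η)) :=
        Real.exp_le_exp.2 (mul_le_mul_of_nonneg_left hv.2 hμ.le)
      have h2 := hf.abs_le_one hw.δ_pos (profile μ a₁ f v)
      calc _ ≤ Real.exp (μ * (zeroGap μ + η)) * 1 := by gcongr
        _ = _ := mul_one _)
  rw [show zeroGap μ + η - (zeroGap μ - η) = 2 * η by ring, abs_of_pos (by linarith)] at this
  rw [Real.norm_eq_abs] at this
  linarith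

end Defect

end DelayEq

namespace DelayEq

/-! ### Curves in spaces of continuous functions -/

section Curves

/-- Evaluating pointwise shows that G is the integral of the norm-continuous curve G'; the
fundamental theorem in C(K, ℝ) then gives the derivative in the maximum norm. -/
lemma hasDerivAt_continuousMap_of_apply {K : Type*} [TopologicalSpace K] [CompactSpace K]
    {G : ℝ → C(K, ℝ)} (G' : C(ℝ, C(K, ℝ)))
    (h : ∀ s k, HasDerivAt (fun s => G s k) (G' s k) s) (s : ℝ) : HasDerivAt G (G' s) s := by
  have hG : G = fun s => G 0 + ∫ u in (0 : ℝ)..s, G' u := by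
    funext s
    ext k
    have h1 := (ContinuousMap.evalCLM ℝ k).intervalIntegral_comp_comm
      (G'.continuous.intervalIntegrable (μ := MeasureTheory.volume) 0 s)
    have h2 : ∫ u in (0 : ℝ)..s, G' u k = G s k - G 0 k :=
      intervalIntegral.integral_eq_sub_of_hasDerivAt (f := fun u => G u k) (fun u _ => h u k)
        (Continuous.intervalIntegrable
          ((ContinuousMap.evalCLM ℝ k).continuous.comp G'.continuous) _ _)
    rw [ContinuousMap.add_apply]
    simp only [ContinuousMap.evalCLM_apply] at h1
    rw [← h1, h2]; ring
  rw [hG]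
  exact (G'.continuous.integral_hasStrictDerivAt 0 s).hasDerivAt.const_add _

lemma hasDerivAt_intervalIntegral_of_continuous {g g' : ℝ → ℝ → ℝ}
    (hg : ∀ s, Continuous (g s)) (hg' : Continuous (Function.uncurry g'))
    (h : ∀ s v, HasDerivAt (fun s => g s v) (g' s v) s) (p q s : ℝ) :
    HasDerivAt (fun s => ∫ v in p..q, g s v) (∫ v in p..q, g' s v) s := by
  obtain ⟨C, hC⟩ := ((isCompact_closedBall s 1).prod (isCompact_uIcc (a := p) (b := q))
    ).exists_bound_of_continuousOn hg'.continuousOn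
  refine (intervalIntegral.hasDerivAt_integral_of_dominated_loc_of_deriv_le
    (F := g) (F' := g') (bound := fun _ => C) (Metric.closedBall_mem_nhds s one_pos)
    (.of_forall fun x => (hg x).aestronglyMeasurable) ((hg s).intervalIntegrable _ _)
    (by fun_prop : Continuous (g' s)).aestronglyMeasurable
    (.of_forall fun v hv x hx => hC (x, v) ⟨hx, uIoc_subset_uIcc hv⟩)
    (continuous_const.intervalIntegrable _ _) (.of_forall fun v _ x _ => h x v)).2

end Curves

/-! ### Smooth dependence of the final segment on the first zero -/

section BranchSegment

variable {μ a₁ a₂ p₁ p₂ δ η ρ θ : ℝ} {a f : ℝ → ℝ}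

/-- The derivative of `branch` with respect to the first zero. -/
noncomputable def branchDeriv (μ a₁ : ℝ) (a f : ℝ → ℝ) (θ t : ℝ) : ℝ :=
  Real.exp (-(μ * t)) * (a₁ * Real.exp (μ * θ) +
    ∫ v in (0 : ℝ)..t, Real.exp (μ * v) * (a v *
      -(deriv f (profile μ a₁ f (v - 1 - θ)) * (-μ * profile μ a₁ f (v - 1 - θ) +
        a₁ * f (descent μ a₁ (v - 1 - θ - 1))))))

lemma continuous_branchDeriv (ha : Continuous a) (hf : ContDiff ℝ 1 f) :
    Continuous (Function.uncurry (branchDeriv μ a₁ a f)) := by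
  have h1 := continuous_profile (μ := μ) (a₁ := a₁) hf.continuous
  have h2 := hf.continuous_deriv le_rfl
  have h3 := continuous_descent (μ := μ) (a₁ := a₁)
  have h4 := hf.continuous
  unfold branchDeriv Function.uncurry
  refine Continuous.mul (by fun_prop) (Continuous.add (by fun_prop) ?_)
  apply intervalIntegral.continuous_parametric_intervalIntegral_of_continuous
    (f := fun (x : ℝ × ℝ) v => Real.exp (μ * v) * (a v *
      -(deriv f (profile μ a₁ f (v - 1 - x.1)) * (-μ * profile μ a₁ f (v - 1 - x.1) +
        a₁ * f (descent μ a₁ (v - 1 - x.1 - 1))))))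
  · unfold Function.uncurry
    fun_prop
  · fun_prop

lemma continuous_branch (ha : Continuous a) (hf : Continuous f) :
    Continuous (Function.uncurry (branch μ a₁ a f)) := by
  have h1 := continuous_profile (μ := μ) (a₁ := a₁) hf
  unfold branch Function.uncurry
  refine Continuous.mul (by fun_prop) (Continuous.add (by fun_prop) ?_)
  apply intervalIntegral.continuous_parametric_intervalIntegral_of_continuous
    (f := fun (x : ℝ × ℝ) v => Real.exp (μ * v) * (a v * f (profile μ a₁ f (v - 1 - x.1))))
  · unfold Function.uncurry
    fun_prop
  · fun_prop

lemma hasDerivAt_branch (hμ : 0 < μ) (ha : Continuous a) (hf : ContDiff ℝ 1 f) (θ t : ℝ) :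
    HasDerivAt (fun θ => branch μ a₁ a f θ t) (branchDeriv μ a₁ a f θ t) θ := by
  have h1 := continuous_profile (μ := μ) (a₁ := a₁) hf.continuous
  have h2 := hf.continuous_deriv le_rfl
  have h3 := continuous_descent (μ := μ) (a₁ := a₁)
  have h4 := hf.continuous
  have hE : HasDerivAt (fun θ => a₁ / μ * (Real.exp (μ * θ) - 1)) (a₁ * Real.exp (μ * θ)) θ := by
    refine ((((hasDerivAt_id θ).const_mul μ).exp.sub_const 1).const_mul (a₁ / μ)).congr_deriv ?_
    simp only [id_eq]
    field_simp
  refine (hE.add (hasDerivAt_intervalIntegral_of_continuous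
    (g := fun θ v => Real.exp (μ * v) * (a v * f (profile μ a₁ f (v - 1 - θ))))
    (g' := fun θ v => Real.exp (μ * v) * (a v *
      -(deriv f (profile μ a₁ f (v - 1 - θ)) * (-μ * profile μ a₁ f (v - 1 - θ) +
        a₁ * f (descent μ a₁ (v - 1 - θ - 1))))))
    (fun s => ?_) ?_ (fun s v => ?_) 0 t θ)).const_mul (Real.exp (-(μ * t)))
  · fun_prop
  · unfold Function.uncurry
    fun_prop
  · have hp : HasDerivAt (fun s => profile μ a₁ f (v - 1 - s)) _ s :=
      (hasDerivAt_profile hf.continuous (v - 1 - s)).comp s ((hasDerivAt_id s).const_sub (v - 1))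
    have hfd := (hf.differentiable one_ne_zero (profile μ a₁ f (v - 1 - s))).hasDerivAt
    refine (((hfd.comp s hp).const_mul (a v)).const_mul (Real.exp (μ * v))).congr_deriv ?_
    ring

/-- The segment on `[T-1,T]` of the branch. -/
noncomputable def branchSegment (μ a₁ : ℝ) {a f : ℝ → ℝ} (ha : Continuous a) (hf : Continuous f)
    (T : ℝ) : C(ℝ, C0) :=
  ContinuousMap.curry ⟨fun x : ℝ × Icc (-1 : ℝ) 0 => branch μ a₁ a f x.1 (T + x.2), by
    exact (continuous_branch (μ := μ) (a₁ := a₁) ha hf).comp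
      (by fun_prop : Continuous fun x : ℝ × Icc (-1 : ℝ) 0 => (x.1, T + (x.2 : ℝ)))⟩

/-- No margins are needed: the branch is defined for every θ by one integral, so differentiation
under the integral sign replaces any smoothness theory for the solution operator. -/
lemma contDiff_branchSegment (hμ : 0 < μ) (ha : Continuous a) (hf : ContDiff ℝ 1 f) (T : ℝ) :
    ContDiff ℝ 1 (branchSegment μ a₁ ha hf.continuous T) := by
  set G' : C(ℝ, C0) := ContinuousMap.curry
    ⟨fun x : ℝ × Icc (-1 : ℝ) 0 => branchDeriv μ a₁ a f x.1 (T + x.2), by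
      exact (continuous_branchDeriv (μ := μ) (a₁ := a₁) ha hf).comp
        (by fun_prop : Continuous fun x : ℝ × Icc (-1 : ℝ) 0 => (x.1, T + (x.2 : ℝ)))⟩ with hG'
  have hd : ∀ s, HasDerivAt (branchSegment μ a₁ ha hf.continuous T) (G' s) s :=
    hasDerivAt_continuousMap_of_apply G' fun s k => hasDerivAt_branch hμ ha hf s (T + k)
  rw [contDiff_one_iff_deriv]
  refine ⟨fun s => (hd s).differentiableAt, ?_⟩
  rw [show deriv (branchSegment μ a₁ ha hf.continuous T) = G' from funext fun s => (hd s).deriv]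
  exact G'.continuous

end BranchSegment

/-! ### Maps which factor through a one-dimensional map -/

section Factor

variable {E : Type*} [NormedAddCommGroup E] [NormedSpace ℝ E] {ev : E →L[ℝ] ℝ} {e v : E}
  {G : ℝ → E} {I : Set ℝ} {lam β h₀ : ℝ}

/-- The parameter of a point on the curve is recovered from its evaluation by q, so the image is a
graph over the line spanned by e. The shear ψ ↦ ψ - G(q(ev ψ)) + (ev ψ) e preserves ev, is inverted
by reversing signs, and flattens the graph; one chart serves all points. -/
lemma isOneDimSubmanifold_image (he : ev e = 1) (hI : IsOpen I) (hG : ContDiffOn ℝ 1 G I)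
    (haff : ∀ h ∈ I, ev (G h) = lam * h + β) (hlam : lam ≠ 0) :
    IsOneDimSubmanifold (G '' I) := by
  set q : ℝ → ℝ := fun s => (s - β) / lam with hq
  have hqc : ContDiff ℝ 1 q := by rw [hq]; fun_prop
  have hqG : ∀ s, q s ∈ I → ev (G (q s)) = s := fun s hs => by
    rw [haff _ hs, hq]; field_simp; ring
  have hqe : ∀ h, q (lam * h + β) = h := fun h => by rw [hq]; field_simp; ring
  set S : Set E := {ψ | q (ev ψ) ∈ I} with hS
  have hSo : IsOpen S := hI.preimage (hqc.continuous.comp ev.continuous)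
  have hk : ContDiffOn ℝ 1 (fun ψ => G (q (ev ψ))) S :=
    hG.comp (hqc.comp ev.contDiff).contDiffOn (fun ψ hψ => hψ)
  have he' : ContDiff ℝ 1 (fun ψ => ev ψ • e) := ev.contDiff.smul contDiff_const
  have hf1 : ContDiffOn ℝ 1 (fun ψ => ψ - G (q (ev ψ)) + ev ψ • e) S :=
    (contDiffOn_id.sub hk).add he'.contDiffOn
  have hf2 : ContDiffOn ℝ 1 (fun ψ => ψ + G (q (ev ψ)) - ev ψ • e) S :=
    (contDiffOn_id.add hk).sub he'.contDiffOn
  have ev1 : ∀ ψ ∈ S, ev (ψ - G (q (ev ψ)) + ev ψ • e) = ev ψ := fun ψ hψ => by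
    simp [hqG _ hψ, he]
  have ev2 : ∀ ψ ∈ S, ev (ψ + G (q (ev ψ)) - ev ψ • e) = ev ψ := fun ψ hψ => by
    simp [hqG _ hψ, he]
  let Φ : OpenPartialHomeomorph E E :=
    { toFun := fun ψ => ψ - G (q (ev ψ)) + ev ψ • e
      invFun := fun ψ => ψ + G (q (ev ψ)) - ev ψ • e
      source := S
      target := S
      map_source' := fun ψ hψ => by
        change q (ev _) ∈ I
        rw [ev1 ψ hψ]; exact hψ
      map_target' := fun ψ hψ => by
        change q (ev _) ∈ I
        rw [ev2 ψ hψ]; exact hψ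
      left_inv' := fun ψ hψ => by
        simp only [ev1 ψ hψ]; abel
      right_inv' := fun ψ hψ => by
        simp only [ev2 ψ hψ]; abel
      open_source := hSo
      open_target := hSo
      continuousOn_toFun := hf1.continuousOn
      continuousOn_invFun := hf2.continuousOn }
  have he0 : e ≠ 0 := by rintro rfl; simp at he
  rintro _ ⟨h, hh, rfl⟩
  refine ⟨Φ, Submodule.span ℝ {e}, ?_, hf1, hf2, finrank_span_singleton he0, ?_⟩
  · change q (ev (G h)) ∈ I
    rwa [haff h hh, hqe]
  · ext χ
    constructor
    · rintro ⟨_, ⟨hS1, ⟨s, hs, rfl⟩⟩, rfl⟩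
      refine ⟨Φ.map_source hS1, ?_⟩
      change G s - G (q (ev (G s))) + ev (G s) • e ∈ _
      rw [haff s hs, hqe, sub_self, zero_add]
      exact Submodule.smul_mem _ _ (Submodule.mem_span_singleton_self e)
    · rintro ⟨hχ, hL⟩
      obtain ⟨s, rfl⟩ := Submodule.mem_span_singleton.1 hL
      have hs : q s ∈ I := by
        have : q (ev (s • e)) ∈ I := hχ
        simpa [he] using this
      refine ⟨G (q s), ⟨?_, ⟨q s, hs, rfl⟩⟩, ?_⟩
      · change q (ev (G (q s))) ∈ I
        rwa [hqG s hs]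
      · change G (q s) - G (q (ev (G (q s)))) + ev (G (q s)) • e = s • e
        rw [hqG s hs, sub_self, zero_add]

lemma ev_deriv_eq (hI : IsOpen I) (h₀I : h₀ ∈ I) (haff : ∀ h ∈ I, ev (G h) = lam * h + β)
    (hv : HasDerivAt G v h₀) : ev v = lam := by
  have h1 : HasDerivAt (fun h => ev (G h)) (ev v) h₀ := ev.hasFDerivAt.comp_hasDerivAt h₀ hv
  have h2 : HasDerivAt (fun h => lam * h + β) (lam * 1) h₀ :=
    ((hasDerivAt_id h₀).const_mul lam).add_const β
  rw [mul_one] at h2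
  exact h1.unique (h2.congr_of_eventuallyEq (Filter.eventually_of_mem (hI.mem_nhds h₀I) haff))

/-- A curve γ in the image satisfies γ = G ∘ q ∘ ev ∘ γ, so by the chain rule its velocity is a
multiple of v. -/
lemma tangentVectors_image (hI : IsOpen I) (h₀I : h₀ ∈ I)
    (haff : ∀ h ∈ I, ev (G h) = lam * h + β) (hlam : lam ≠ 0) (hv : HasDerivAt G v h₀) :
    tangentVectors (G '' I) (G h₀) = (Submodule.span ℝ {v} : Submodule ℝ E) := by
  ext w
  rw [SetLike.mem_coe, Submodule.mem_span_singleton]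
  constructor
  · rintro ⟨γ, hγ0, hγW, hγ⟩
    set q : ℝ → ℝ := fun s => (s - β) / lam with hq
    have h1 : HasDerivAt (fun t => q (ev (γ t))) (ev w / lam) 0 :=
      ((ev.hasFDerivAt.comp_hasDerivAt 0 hγ).sub_const β).div_const lam
    have h2 : q (ev (γ 0)) = h₀ := by rw [hγ0, haff _ h₀I, hq]; field_simp; ring
    have h3 : HasDerivAt (fun t => G (q (ev (γ t)))) ((ev w / lam) • v) 0 :=
      HasDerivAt.scomp (h := fun t => q (ev (γ t))) (h' := ev w / lam) 0 (by rwa [h2]) h1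
    have h4 : γ =ᶠ[𝓝 0] fun t => G (q (ev (γ t))) := by
      filter_upwards [hγW] with t ht
      obtain ⟨s, hs, hst⟩ := ht
      have : q (ev (γ t)) = s := by rw [← hst, haff s hs, hq]; field_simp; ring
      rw [this, hst]
    exact ⟨ev w / lam, (h3.congr_of_eventuallyEq h4).unique hγ⟩
  · rintro ⟨c, rfl⟩
    have h1 : HasDerivAt (fun t : ℝ => h₀ + c * t) c 0 := by
      simpa using ((hasDerivAt_id (0 : ℝ)).const_mul c).const_add h₀
    refine ⟨fun t => G (h₀ + c * t), by simp, ?_, ?_⟩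
    · have h2 : Tendsto (fun t : ℝ => h₀ + c * t) (𝓝 0) (𝓝 h₀) := by
        simpa using h1.continuousAt.tendsto
      filter_upwards [h2 (hI.mem_nhds h₀I)] with t ht
      exact ⟨_, ht, rfl⟩
    · exact HasDerivAt.scomp (h := fun t : ℝ => h₀ + c * t) (h' := c) 0 (by simpa using hv) h1

lemma eigenspace_smulRight (hv : ev v = lam) (hlam : lam ≠ 0) :
    Module.End.eigenspace ((ev.smulRight v : E →L[ℝ] E) : E →ₗ[ℝ] E) lam =
      Submodule.span ℝ {v} := by
  ext w
  rw [Module.End.mem_eigenspace_iff, Submodule.mem_span_singleton]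
  simp only [ContinuousLinearMap.coe_coe, ContinuousLinearMap.smulRight_apply]
  constructor
  · intro h
    refine ⟨ev w / lam, ?_⟩
    rw [div_eq_inv_mul, mul_smul, h, smul_smul, inv_mul_cancel₀ hlam, one_smul]
  · rintro ⟨c, rfl⟩
    rw [map_smul, hv, smul_eq_mul, smul_smul, mul_comm]

/-- For this rank-one operator the two spaces are ker ev and the line through v, which are
complementary because ev v ≠ 0. -/
lemma isCompl_eigenspace_smulRight (hv : ev v = lam) (hlam : lam ≠ 0) :
    IsCompl (Module.End.eigenspace ((ev.smulRight v : E →L[ℝ] E) : E →ₗ[ℝ] E) 0)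
      (Module.End.eigenspace ((ev.smulRight v : E →L[ℝ] E) : E →ₗ[ℝ] E) lam) := by
  have hv0 : v ≠ 0 := by rintro rfl; exact hlam (by simpa using hv.symm)
  have hker : ∀ w, w ∈ Module.End.eigenspace ((ev.smulRight v : E →L[ℝ] E) : E →ₗ[ℝ] E) 0 ↔
      ev w = 0 := fun w => by
    rw [Module.End.mem_eigenspace_iff, zero_smul]
    simp [hv0]
  rw [eigenspace_smulRight hv hlam]
  refine ⟨Submodule.disjoint_def.2 fun w h1 h2 => ?_, codisjoint_iff.2 (eq_top_iff.2 fun w _ => ?_)⟩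
  · obtain ⟨c, rfl⟩ := Submodule.mem_span_singleton.1 h2
    rw [hker, map_smul, hv, smul_eq_mul] at h1
    rw [(mul_eq_zero.1 h1).resolve_right hlam, zero_smul]
  · refine Submodule.mem_sup.2 ⟨w - (ev w / lam) • v, ?_, (ev w / lam) • v,
      Submodule.smul_mem _ _ (Submodule.mem_span_singleton_self v), by abel⟩
    rw [hker, map_sub, map_smul, hv, smul_eq_mul, div_mul_cancel₀ _ hlam, sub_self]

end Factor

end DelayEq

namespace DelayEq

/-! ### The period map, periodic solutions and stability -/

section PeriodMap

variable {μ T A : ℝ} {a f : ℝ → ℝ} {K : NNReal} {P : C0 → C0} {φ : C0} {x p q : ℝ → ℝ}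

lemma exists_isPeriodMap (hμ : 0 < μ) (hT : 0 ≤ T) (ha : Continuous a) (hA : ∀ t, |a t| ≤ A)
    (hK : LipschitzWith K f) : ∃ P, IsPeriodMap μ a f T P := by
  choose X hX using fun φ : C0 => exists_isSolutionFrom (μ := μ) ha hK.continuous φ
  refine ⟨fun φ => segment (X φ) T
    ((hX φ).continuousOn.mono (Ici_subset_Ici.2 (by linarith))),
    fun φ => ⟨⟨X φ, hX φ⟩, fun x hx θ => ?_⟩⟩
  exact (hX φ).eq_of_isSolutionFrom hμ ha hA hK hx (by linarith [θ.2.1])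

lemma exists_abs_le_of_periodic {c : ℝ → ℝ} (hc : Function.Periodic c T) (hT : 0 < T)
    (hcc : Continuous c) : ∃ A, ∀ t, |c t| ≤ A := by
  obtain ⟨A, hA⟩ := (isCompact_Icc (a := (0 : ℝ)) (b := T)).exists_bound_of_continuousOn
    hcc.continuousOn
  refine ⟨A, fun t => ?_⟩
  obtain ⟨s, hs, hts⟩ := hc.exists_mem_Ico₀ hT t
  rw [hts]
  exact hA s ⟨hs.1, hs.2.le⟩

lemma IsPeriodicSolution.continuous (hp : IsPeriodicSolution μ a f T p) : Continuous p :=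
  continuous_iff_continuousAt.2 fun t => (hp.equation t).continuousAt

lemma IsPeriodicSolution.isSolutionFrom (hp : IsPeriodicSolution μ a f T p) {σ : ℝ}
    (hφ : ∀ θ : Icc (-1 : ℝ) 0, p (σ + θ) = φ θ) : IsSolutionFrom μ a f σ φ p :=
  ⟨hp.continuous.continuousOn, hφ, fun t _ => (hp.equation t).hasDerivWithinAt⟩

lemma IsPeriodMap.apply_periodic (hP : IsPeriodMap μ a f T P) (hp : IsPeriodicSolution μ a f T p)
    (hφ : ∀ θ : Icc (-1 : ℝ) 0, φ θ = p θ) : P φ = φ := by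
  ext θ
  rw [(hP φ).2 p (hp.isSolutionFrom fun θ => by rw [zero_add, hφ]), hφ, add_comm, hp.periodic]

/-- Periodicity moves negative times into the range of forward uniqueness; delay equations offer no
backward uniqueness in general. -/
lemma IsPeriodicSolution.eq_of_initial (hμ : 0 < μ) (hT : 0 < T) (ha : Continuous a)
    (hA : ∀ t, |a t| ≤ A) (hK : LipschitzWith K f) (hp : IsPeriodicSolution μ a f T p)
    (hq : IsPeriodicSolution μ a f T q) (hpφ : ∀ θ : Icc (-1 : ℝ) 0, φ θ = p θ)
    (hqφ : ∀ θ : Icc (-1 : ℝ) 0, φ θ = q θ) : p = q := by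
  funext t
  obtain ⟨n, hn⟩ := exists_nat_ge (-t / T)
  rw [div_le_iff₀ hT] at hn
  rw [← hp.periodic.nat_mul n t, ← hq.periodic.nat_mul n t]
  exact (hp.isSolutionFrom fun θ => by rw [zero_add, hpφ]).eq_of_isSolutionFrom hμ ha hA hK
    (hq.isSolutionFrom fun θ => by rw [zero_add, hqφ]) (by linarith)

/-- A fixed point of the period map is the initial state of a periodic solution. -/
lemma IsPeriodMap.exists_isPeriodicSolution (hμ : 0 < μ) (hT : 0 < T) (ha : Continuous a)
    (hper : Function.Periodic a T) (hA : ∀ t, |a t| ≤ A) (hK : LipschitzWith K f)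
    (hP : IsPeriodMap μ a f T P) (hφ : P φ = φ) :
    ∃ p, IsPeriodicSolution μ a f T p ∧ ∀ θ : Icc (-1 : ℝ) 0, φ θ = p θ := by
  obtain ⟨x, hx⟩ := (hP φ).1
  have hxT : ∀ t, -1 ≤ t → x (t + T) = x t := by
    intro t ht
    have h1 : IsSolutionFrom μ a f T φ x := hx.restart hT.le fun θ => by
      rw [← (hP φ).2 x hx θ, hφ]
    exact (h1.shift hper (zero_add T)).eq_of_isSolutionFrom hμ ha hA hK hx (by linarith)
  have hxn : ∀ (n : ℕ) t, -1 ≤ t → x (t + n * T) = x t := by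
    intro n
    induction n with
    | zero => intro t _; simp
    | succ n ih =>
      intro t ht
      have h0 : 0 ≤ n * T := by positivity
      rw [← ih t ht, ← hxT (t + n * T) (by linarith)]
      push_cast; congr 1; ring
  -- The periodic extension of x on [0,T). It has to be compared with x on [-1,0) as well, since the
  -- delayed term reads those values.
  set p : ℝ → ℝ := fun t => x (T * Int.fract (t / T)) with hp
  have hpx : ∀ t, -1 ≤ t → p t = x t := by
    intro t ht
    have hfr : T * Int.fract (t / T) = t - ⌊t / T⌋ * T := by
      rw [Int.fract]; field_simp
    have hfr0 : 0 ≤ T * Int.fract (t / T) := mul_nonneg hT.le (Int.fract_nonneg _)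
    rcases le_total 0 ⌊t / T⌋ with h | h
    · obtain ⟨n, hn⟩ := Int.eq_ofNat_of_zero_le h
      rw [hp]
      dsimp only
      rw [← hxn n _ (by linarith), hfr, hn]
      congr 1; push_cast; ring
    · obtain ⟨n, hn⟩ := Int.eq_ofNat_of_zero_le (neg_nonneg.2 h)
      have hn' : (⌊t / T⌋ : ℝ) = -(n : ℝ) := by
        have : ⌊t / T⌋ = -(n : ℤ) := by omega
        rw [this]; push_cast; rfl
      rw [← hxn n t ht, hp]
      dsimp only
      rw [hfr, hn']
      congr 1; ring
  have hpp : Function.Periodic p T := by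
    intro t
    rw [hp]
    dsimp only
    rw [add_div, div_self hT.ne', Int.fract_add_one]
  refine ⟨p, ⟨fun t => ?_, hpp⟩, fun θ => ?_⟩
  -- After a shift to a strictly positive time, the one-sided derivative of x is two-sided.
  · obtain ⟨n, hn⟩ := exists_nat_gt (-t / T)
    rw [div_lt_iff₀ hT] at hn
    have h1 := (hx.equation (t + n * T) (by linarith)).hasDerivAt (Ici_mem_nhds (by linarith))
    have h2 : HasDerivAt p (-μ * x (t + n * T) + a (t + n * T) * f (x (t + n * T - 1)))
        (t + n * T) :=
      h1.congr_of_eventuallyEq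
        (Filter.eventually_of_mem (Ici_mem_nhds (a := -1) (by linarith)) hpx)
    have h3 : HasDerivAt (fun s => p (s + n * T))
        (-μ * x (t + n * T) + a (t + n * T) * f (x (t + n * T - 1))) t := h2.comp_add_const t _
    rw [← hpx _ (by linarith), ← hpx (t + n * T - 1) (by linarith), hper.nat_mul n t,
      show t + n * T - 1 = t - 1 + n * T by ring, hpp.nat_mul n t, hpp.nat_mul n (t - 1)] at h3
    exact h3.congr_of_eventuallyEq (.of_forall fun s => (hpp.nat_mul n s).symm)
  · rw [hpx _ θ.2.1, ← hx.initial, zero_add]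

lemma IsPeriodMap.isSolutionFrom_iterate (hT : 0 ≤ T) (hper : Function.Periodic a T)
    (hP : IsPeriodMap μ a f T P) (hx : IsSolutionFrom μ a f 0 φ x) (n : ℕ) :
    IsSolutionFrom μ a f 0 (P^[n] φ) (fun t => x (t + n * T)) := by
  induction n with
  | zero => simpa using hx
  | succ n ih =>
    have h1 : IsSolutionFrom μ a f T (P (P^[n] φ)) (fun t => x (t + n * T)) :=
      ih.restart hT fun θ => ((hP _).2 _ ih θ).symm
    have h2 := h1.shift hper (zero_add T)
    rw [← Function.iterate_succ_apply' P n φ] at h2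
    have e : (fun t => x (t + ((n + 1 : ℕ) : ℝ) * T)) = fun t => x (t + T + n * T) := by
      funext t; congr 1; push_cast; ring
    rw [e]
    exact h2

variable {G : ℝ → C0} {ht lam r₀ : ℝ}

lemma abs_ev0_sub_le (φ ψ : C0) : |ev0 φ - ev0 ψ| ≤ dist φ ψ := by
  rw [← Real.dist_eq]; exact ContinuousMap.dist_apply_le_dist _

/-- Near the fixed point, iterates of the period map stay close and converge. -/
lemma exists_iterate_bound (hr₀ : 0 < r₀)
    (hPG : ∀ ψ, dist ψ φ < r₀ → P ψ = G (ev0 ψ)) (hGφ : G (ev0 φ) = φ)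
    (hG : ContinuousAt G (ev0 φ)) (hlam : |lam| < 1)
    (haff : ∀ ψ, dist ψ φ < r₀ → ev0 (P ψ) - ev0 φ = lam * (ev0 ψ - ev0 φ))
    {ε : ℝ} (hε : 0 < ε) : ∃ η > 0, ∀ ψ, dist ψ φ < η →
      (∀ n, dist (P^[n] ψ) φ < ε) ∧ Tendsto (fun n => dist (P^[n] ψ) φ) atTop (𝓝 0) := by
  obtain ⟨κ, hκ, hκG⟩ := Metric.continuousAt_iff.1 hG (min ε r₀) (lt_min hε hr₀)
  rw [hGφ] at hκG
  refine ⟨min κ (min ε r₀), by positivity, fun ψ hψ => ?_⟩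
  have h0 : |ev0 ψ - ev0 φ| < κ := (abs_ev0_sub_le ψ φ).trans_lt (hψ.trans_le (min_le_left _ _))
  -- The next iterate depends only on the evaluation, which never moves away from its fixed value;
  -- the choice of κ thus keeps all iterates in the ball where the factorization is valid.
  have key : ∀ n, dist (P^[n] ψ) φ < min ε r₀ ∧
      ev0 (P^[n] ψ) - ev0 φ = lam ^ n * (ev0 ψ - ev0 φ) := by
    intro n
    induction n with
    | zero => exact ⟨hψ.trans_le (min_le_right _ _), by simp⟩
    | succ n ih =>
      obtain ⟨ih1, ih2⟩ := ih
      have ih1' := ih1.trans_le (min_le_right _ _)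
      rw [Function.iterate_succ_apply']
      constructor
      · rw [hPG _ ih1']
        apply hκG
        rw [Real.dist_eq, ih2, abs_mul, abs_pow]
        calc _ ≤ 1 * |ev0 ψ - ev0 φ| := by
              gcongr; exact pow_le_one₀ (abs_nonneg _) hlam.le
          _ < κ := by rwa [one_mul]
      · rw [haff _ ih1', ih2]; ring
  refine ⟨fun n => (key n).1.trans_le (min_le_left _ _), ?_⟩
  have h1 : Tendsto (fun n => ev0 (P^[n] ψ)) atTop (𝓝 (ev0 φ)) := by
    have h2 : Tendsto (fun n => lam ^ n * (ev0 ψ - ev0 φ) + ev0 φ) atTop (𝓝 (ev0 φ)) := by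
      simpa using ((tendsto_pow_atTop_nhds_zero_of_abs_lt_one hlam).mul_const
        (ev0 ψ - ev0 φ)).add_const (ev0 φ)
    exact h2.congr fun n => by rw [← (key n).2]; ring
  have h3 : Tendsto (fun n => P^[n + 1] ψ) atTop (𝓝 φ) := by
    have h4 := hG.tendsto.comp h1
    rw [hGφ] at h4
    refine h4.congr fun n => ?_
    rw [Function.iterate_succ_apply', hPG _ ((key n).1.trans_le (min_le_right _ _))]
    rfl
  exact tendsto_iff_dist_tendsto_zero.1 ((tendsto_add_atTop_iff_nat 1).1 h3)

/-- Within a period the distance to p is at most C times that of the current iterate of P from φ, by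
continuous dependence. A start at time σ costs a further factor D for reaching the next multiple of
T. -/
lemma IsPeriodMap.isAsymptoticallyStable (hμ : 0 < μ) (hT : 0 < T) (ha : Continuous a)
    (hper : Function.Periodic a T) (hA : ∀ t, |a t| ≤ A) (hK : LipschitzWith K f)
    (hP : IsPeriodMap μ a f T P) (hp : IsPeriodicSolution μ a f T p)
    (hpφ : ∀ θ : Icc (-1 : ℝ) 0, φ θ = p θ) (hr₀ : 0 < r₀)
    (hPG : ∀ ψ, dist ψ φ < r₀ → P ψ = G (ev0 ψ)) (hGφ : G (ev0 φ) = φ)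
    (hG : ContinuousAt G (ev0 φ)) (hlam : |lam| < 1)
    (haff : ∀ ψ, dist ψ φ < r₀ → ev0 (P ψ) - ev0 φ = lam * (ev0 ψ - ev0 φ)) :
    IsAsymptoticallyStable μ a f p := by
  have hA0 : 0 ≤ A := (abs_nonneg _).trans (hA 0)
  have hB : (1 : ℝ) ≤ 1 + A * K := by have := mul_nonneg hA0 K.coe_nonneg; linarith
  have hp0 : IsSolutionFrom μ a f 0 φ p := hp.isSolutionFrom fun θ => by rw [zero_add, hpφ]
  obtain ⟨N, hN⟩ := exists_nat_ge T
  set C := (1 + A * K) ^ N with hC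
  have hC0 : 0 < C := by positivity
  -- solutions starting at time `0`
  have hbound : ∀ {ψ : C0} {x : ℝ → ℝ}, IsSolutionFrom μ a f 0 ψ x → ∀ t, 0 ≤ t →
      |x t - p t| ≤ dist (P^[⌊t / T⌋₊] ψ) φ * C := by
    intro ψ x hx t ht
    have h1 := hP.isSolutionFrom_iterate hT.le hper hx ⌊t / T⌋₊
    have h2 : (⌊t / T⌋₊ : ℝ) ≤ t / T := Nat.floor_le (by positivity)
    have h3 : t / T < ⌊t / T⌋₊ + 1 := Nat.lt_floor_add_one _
    rw [le_div_iff₀ hT] at h2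
    rw [div_lt_iff₀ hT] at h3
    have h4 := abs_sub_le_of_isSolutionFrom hμ ha hA hK h1 hp0
      (d := dist (P^[⌊t / T⌋₊] ψ) φ) (fun θ => by
        rw [← Real.dist_eq]; exact ContinuousMap.dist_apply_le_dist _) N (t - ⌊t / T⌋₊ * T)
      (by linarith) (by linarith)
    rwa [sub_add_cancel, hp.periodic.sub_nat_mul_eq] at h4
  have hfloor : Tendsto (fun t : ℝ => ⌊t / T⌋₊) atTop atTop :=
    tendsto_nat_floor_atTop.comp (tendsto_id.atTop_div_const hT)
  -- arbitrary starting times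
  intro σ
  set n : ℤ := ⌈σ / T⌉ with hn
  have hnσ : σ ≤ n * T := by rw [← div_le_iff₀ hT]; exact Int.le_ceil _
  obtain ⟨L, hL⟩ := exists_nat_ge (n * T - σ)
  set D := (1 + A * K) ^ L with hD
  have hD0 : 0 < D := by positivity
  have hper' : Function.Periodic a (n * T) := hper.int_mul n
  have hpσ : IsSolutionFrom μ a f σ (segment p σ hp.continuous.continuousOn) p :=
    hp.isSolutionFrom fun θ => rfl
  have hearly : ∀ {η : ℝ} {ψ : C0} {x : ℝ → ℝ}, IsSolutionFrom μ a f σ ψ x →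
      (∀ θ : Icc (-1 : ℝ) 0, |ψ θ - p (σ + θ)| < η) → ∀ t, σ - 1 ≤ t → t ≤ n * T →
        |x t - p t| ≤ η * D := by
    intro η ψ x hx h t ht1 ht2
    exact abs_sub_le_of_isSolutionFrom hμ ha hA hK hx hpσ (fun θ => (h θ).le) L t ht1
      (by linarith)
  have hlate : ∀ {η : ℝ} {ψ : C0} {x : ℝ → ℝ}, IsSolutionFrom μ a f σ ψ x →
      (∀ θ : Icc (-1 : ℝ) 0, |ψ θ - p (σ + θ)| < η) →
        ∃ χ : C0, IsSolutionFrom μ a f 0 χ (fun t => x (t + n * T)) ∧ dist χ φ ≤ η * D := by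
    intro η ψ x hx h
    refine ⟨segment x (n * T) (hx.continuousOn.mono (Ici_subset_Ici.2 (by linarith))),
      (hx.restart hnσ fun θ => rfl).shift hper' (zero_add _), ?_⟩
    have hη : 0 ≤ η := (abs_nonneg _).trans (h ⟨0, by norm_num⟩).le
    rw [ContinuousMap.dist_le (by positivity)]
    intro θ
    have h1 := hearly hx h (n * T + θ) (by linarith [θ.2.1]) (by linarith [θ.2.2])
    rw [Real.dist_eq, hpφ]
    have h2 : p (n * T + θ) = p θ := by rw [add_comm]; exact hp.periodic.int_mul n θ
    rw [h2] at h1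
    exact h1
  have hshift : ∀ {χ : C0} {x : ℝ → ℝ}, IsSolutionFrom μ a f 0 χ (fun t => x (t + n * T)) →
      ∀ t, n * T ≤ t → |x t - p t| ≤ dist (P^[⌊(t - n * T) / T⌋₊] χ) φ * C := by
    intro χ x hχ t ht
    have := hbound hχ (t - n * T) (by linarith)
    rwa [sub_add_cancel, hp.periodic.sub_int_mul_eq] at this
  constructor
  · intro ε hε
    obtain ⟨κ, hκ, hκP⟩ := exists_iterate_bound hr₀ hPG hGφ hG hlam haff (div_pos hε hC0)
    -- The ε serves times before n T and the κ those after; the 2 makes the inequalities strict.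
    refine ⟨min κ ε / (2 * D), by positivity, fun ψ x hx h t ht => ?_⟩
    have hηD : min κ ε / (2 * D) * D < min κ ε := by
      have : 0 < min κ ε := lt_min hκ hε
      rw [div_mul_eq_mul_div, div_lt_iff₀ (by positivity)]
      nlinarith
    rcases le_total t (n * T) with h1 | h1
    · exact (hearly hx h t (by linarith) h1).trans_lt (hηD.trans_le (min_le_right _ _))
    · obtain ⟨χ, hχ, hd⟩ := hlate hx h
      have h2 := (hκP χ (hd.trans_lt (hηD.trans_le (min_le_left _ _)))).1 ⌊(t - n * T) / T⌋₊
      rw [lt_div_iff₀ hC0] at h2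
      exact (hshift hχ t h1).trans_lt h2
  · obtain ⟨κ, hκ, hκP⟩ := exists_iterate_bound hr₀ hPG hGφ hG hlam haff one_pos
    refine ⟨κ / (2 * D), by positivity, fun ψ x hx h => ?_⟩
    have hηD : κ / (2 * D) * D < κ := by
      rw [div_mul_eq_mul_div, div_lt_iff₀ (by positivity)]
      nlinarith
    obtain ⟨χ, hχ, hd⟩ := hlate hx h
    have h2 := (hκP χ (hd.trans_lt hηD)).2
    have h3 : Tendsto (fun t : ℝ => ⌊(t - n * T) / T⌋₊) atTop atTop :=
      hfloor.comp (tendsto_atTop_add_const_right atTop (-(n * T)) tendsto_id)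
    have h4 := (h2.comp h3).mul_const C
    rw [zero_mul] at h4
    refine squeeze_zero_norm' ?_ h4
    filter_upwards [eventually_ge_atTop (n * T)] with t ht
    exact hshift hχ t ht

end PeriodMap

end DelayEq

namespace DelayEq

/-! ### The one-dimensional map and the choice of constants -/

section Affine

variable {μ a₁ a₂ p₁ p₂ δ η ρ θ h : ℝ} {a f : ℝ → ℝ}

lemma exp_firstZero (hμ : 0 < μ) (ha₁ : 0 < a₁) (hh : 0 < h) :
    a₁ / μ * (Real.exp (μ * firstZero μ a₁ h) - 1) = h := by
  rw [firstZero, ← mul_assoc, mul_one_div_cancel hμ.ne', one_mul, Real.exp_log (by positivity)]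
  field_simp
  ring

lemma firstZero_pos (hμ : 0 < μ) (ha₁ : 0 < a₁) (hh : 0 < h) : 0 < firstZero μ a₁ h := by
  have : 0 < h * μ := by positivity
  refine mul_pos (by positivity) (Real.log_pos ?_)
  rw [lt_div_iff₀ ha₁]
  linarith

lemma contDiffOn_firstZero (hμ : 0 < μ) (ha₁ : 0 < a₁) : ContDiffOn ℝ 1 (firstZero μ a₁) (Ioi 0) := by
  unfold firstZero
  refine contDiffOn_const.mul (ContDiffOn.log (by fun_prop) fun h hh => ?_)
  have : 0 < h := hh
  positivity

/-- The argument of the second logarithm is 2 - exp(-μ), which is `zeroGapExp` times exp(-μ). -/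
lemma secondZero_eq (hμ : 0 < μ) (ha₁ : 0 < a₁) :
    secondZero μ a₁ h = firstZero μ a₁ h + zeroGap μ := by
  have hc : (a₁ - μ * xOne μ a₁) / a₁ = zeroGapExp μ * Real.exp (-μ) := by
    have := exp_neg_mul_exp μ
    rw [xOne, zeroGapExp]
    field_simp
    linear_combination (-2) * this
  rw [secondZero, zeroGap, hc, Real.log_mul (zeroGapExp_pos hμ).ne' (Real.exp_pos _).ne',
    Real.log_exp]
  field_simp
  ring

/-- This puts the step map into the form of `exp_mul_branch_period`, from which it differs only by
the defect term. -/
lemma exp_mul_stepMap (hμ : 0 < μ) (ha₁ : 0 < a₁) (hθ : a₁ / μ * (Real.exp (μ * θ) - 1) = h) :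
    Real.exp (μ * (p₁ + p₂)) * stepMap μ a₁ a₂ p₁ p₂ h =
      Real.exp (μ * θ) * (-(a₁ / μ * zeroGapExp μ) + 2 * (a₂ / μ) * zeroGapExp μ * Real.exp μ) +
        (a₁ - a₂) / μ * Real.exp (μ * p₁) - a₂ / μ * Real.exp (μ * (p₁ + p₂)) := by
  have e1 : Real.exp (-μ * (p₁ + p₂ - 2)) =
      Real.exp μ ^ 2 / (Real.exp (μ * p₁) * Real.exp (μ * p₂)) := by
    rw [← Real.exp_add, ← Real.exp_nat_mul, ← Real.exp_sub]; congr 1; push_cast; ring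
  have e2 : Real.exp (-μ * p₂) = (Real.exp (μ * p₂))⁻¹ := by rw [← Real.exp_neg]; congr 1; ring
  have e3 : Real.exp (μ * (p₁ + p₂)) = Real.exp (μ * p₁) * Real.exp (μ * p₂) := by
    rw [← Real.exp_add]; congr 1; ring
  rw [← hθ, stepMap, mCoef, bCoef, zeroGapExp, e1, e2, e3, Real.exp_neg μ]
  have := (Real.exp_pos μ).ne'
  have := (Real.exp_pos (μ * p₁)).ne'
  have := (Real.exp_pos (μ * p₂)).ne'
  field_simp
  ring

/-- The slope of the one-dimensional map of the smoothed equation, for defect `κ`. -/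
noncomputable def smoothSlope (μ a₁ a₂ p₁ p₂ κ : ℝ) : ℝ :=
  mCoef μ a₁ a₂ p₁ p₂ + a₂ * μ / a₁ * Real.exp (μ * (1 - (p₁ + p₂))) * κ

/-- The constant term of the one-dimensional map of the smoothed equation, for defect `κ`. -/
noncomputable def smoothConst (μ a₁ a₂ p₁ p₂ κ : ℝ) : ℝ :=
  bCoef μ a₁ a₂ p₁ p₂ + a₂ * Real.exp (μ * (1 - (p₁ + p₂))) * κ

lemma branch_period (hμ : 0 < μ) (ha₁ : 0 < a₁) (hρ : 0 < ρ)
    (hf : IsSmoothFeedback μ a₁ δ f) (ha : IsSmoothCoefficient μ a₁ a₂ p₁ p₂ ρ a)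
    (hw : Window μ a₁ δ η) (hm : Margins μ a₁ a₂ p₁ p₂ δ η ρ θ)
    (hθ : a₁ / μ * (Real.exp (μ * θ) - 1) = h) :
    branch μ a₁ a f θ (p₁ + p₂) = smoothSlope μ a₁ a₂ p₁ p₂ (defect μ a₁ f η) * h +
      smoothConst μ a₁ a₂ p₁ p₂ (defect μ a₁ f η) := by
  refine mul_left_cancel₀ (Real.exp_pos (μ * (p₁ + p₂))).ne' ?_
  have h1 := exp_mul_stepMap (p₁ := p₁) (p₂ := p₂) (a₂ := a₂) hμ ha₁ hθ
  rw [stepMap] at h1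
  have e : Real.exp (μ * (p₁ + p₂)) * Real.exp (μ * (1 - (p₁ + p₂))) = Real.exp μ := by
    rw [← Real.exp_add]; congr 1; ring
  have hE : Real.exp (μ * θ) = μ / a₁ * h + 1 := by rw [← hθ]; field_simp; ring
  rw [exp_mul_branch_period hμ ha₁ hρ hf ha hw hm, smoothSlope, smoothConst]
  set κ := defect μ a₁ f η
  linear_combination (-1) * h1 + (a₂ * Real.exp μ * κ) * hE -
    (a₂ * κ * (μ / a₁ * h + 1)) * e

/-- Since T > ω + 1, the product (2 - exp(-μ)) exp(-μ(T-2)) lies in (0,1), while the remaining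
factor of m exceeds -1. -/
lemma neg_one_lt_mCoef (hμ : 0 < μ) (ha₁ : 0 < a₁) (ha₂ : 0 < a₂) (hθ : 0 < θ)
    (hT : θ + zeroGap μ + 1 < p₁ + p₂) : -1 < mCoef μ a₁ a₂ p₁ p₂ := by
  have h0 := zeroGapExp_pos hμ
  have h1 : Real.exp (-μ * (p₁ + p₂ - 2)) < Real.exp μ * (zeroGapExp μ)⁻¹ := by
    rw [← exp_mul_zeroGap hμ, ← Real.exp_neg, ← Real.exp_add]
    apply Real.exp_lt_exp.2
    nlinarith
  have h2 : 2 - Real.exp (-μ) = zeroGapExp μ * Real.exp (-μ) := by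
    rw [zeroGapExp]; linear_combination (-2) * exp_neg_mul_exp μ
  have h3 := Real.exp_pos (-μ)
  have h4 : Real.exp (-μ) < 1 := Real.exp_lt_one_iff.2 (by linarith)
  have h5 := Real.exp_pos (-μ * (p₁ + p₂ - 2))
  have h6 : (2 - Real.exp (-μ)) * Real.exp (-μ * (p₁ + p₂ - 2)) < 1 := by
    calc _ < (2 - Real.exp (-μ)) * (Real.exp μ * (zeroGapExp μ)⁻¹) :=
          mul_lt_mul_of_pos_left h1 (by linarith)
      _ = 1 := by
        rw [h2]
        have := exp_neg_mul_exp μ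
        field_simp
        exact this
  have h7 : 0 < (2 - Real.exp (-μ)) * Real.exp (-μ * (p₁ + p₂ - 2)) := by
    have : 0 < 2 - Real.exp (-μ) := by linarith
    positivity
  have h8 : 0 < a₂ / a₁ := by positivity
  rw [mCoef, mul_assoc]
  nlinarith

/-- At δ = η = ρ = 0 every margin is a strict inequality, hence persists nearby by continuity. -/
lemma eventually_margins (hμ : 0 < μ) (ha₁ : 0 < a₁) (ha₂ : 0 < a₂) (hh : 0 < h)
    (h₁ : secondZero μ a₁ h < p₁) (h₂ : p₁ < secondZero μ a₁ h + 1)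
    (h₃ : secondZero μ a₁ h + 1 < p₁ + p₂) (hfix : stepMap μ a₁ a₂ p₁ p₂ h = h) :
    ∀ᶠ z : ℝ × ℝ × ℝ × ℝ in 𝓝 (firstZero μ a₁ h, 0, 0, 0),
      Margins μ a₁ a₂ p₁ p₂ z.2.2.1 z.2.1 z.2.2.2 z.1 := by
  rw [secondZero_eq hμ ha₁] at h₁ h₂ h₃
  set θ := firstZero μ a₁ h
  have hθ : a₁ / μ * (Real.exp (μ * θ) - 1) = h := exp_firstZero hμ ha₁ hh
  have hθ0 : 0 < θ := firstZero_pos hμ ha₁ hh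
  have key : ∀ u v : ℝ × ℝ × ℝ × ℝ → ℝ, Continuous u → Continuous v →
      u (θ, 0, 0, 0) < v (θ, 0, 0, 0) → ∀ᶠ z in 𝓝 (θ, 0, 0, 0), u z < v z :=
    fun u v hu hv h => hu.continuousAt.eventually_lt hv.continuousAt h
  have hgapE : zeroGapExp μ * Real.exp (μ * θ) = Real.exp (μ * (θ + zeroGap μ)) := by
    rw [← exp_mul_zeroGap hμ, ← Real.exp_add]; congr 1; ring
  have hrise : Real.exp (μ * (θ + zeroGap μ)) < Real.exp (μ * p₁) :=
    Real.exp_lt_exp.2 (mul_lt_mul_of_pos_left h₁ hμ)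
  filter_upwards [
    key (fun z => z.2.2.2) (fun z => z.1 - z.2.1) (by fun_prop) (by fun_prop) (by simpa using hθ0),
    key (fun z => zeroGap μ + z.2.1) (fun z => p₁ - z.1) (by fun_prop) (by fun_prop)
      (by simp only; linarith),
    key (fun z => p₁ + z.2.2.2 - 1 - z.1) (fun z => zeroGap μ - z.2.1) (by fun_prop) (by fun_prop)
      (by simp only; linarith),
    key (fun z => zeroGap μ + z.2.1) (fun z => p₁ + p₂ - 1 - z.1) (by fun_prop) (by fun_prop)
      (by simp only; linarith),
    key (fun z => μ * z.2.2.1) (fun _ => a₂) (by fun_prop) (by fun_prop) (by simpa using ha₂),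
    key (fun z => z.2.2.1 * Real.exp (μ * z.2.2.2) +
      2 * max a₁ a₂ * (z.2.2.2 * Real.exp (μ * z.2.2.2)))
      (fun z => a₁ / μ * (Real.exp (μ * z.1) - 1)) (by fun_prop) (by fun_prop)
      (by simp only; rw [hθ]; simpa using hh),
    key (fun z => z.2.2.1 * Real.exp (μ * (p₁ + z.2.2.2)))
      (fun z => a₁ / μ * (Real.exp (μ * p₁) - zeroGapExp μ * Real.exp (μ * z.1)))
      (by fun_prop) (by fun_prop) (by
        simp only
        rw [zero_mul, hgapE]
        exact mul_pos (by positivity) (by linarith)),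
    key (fun z => (z.2.2.1 + a₂ / μ) * Real.exp (μ * (p₁ + p₂)))
      (fun z => a₁ / μ * (Real.exp (μ * p₁) - zeroGapExp μ * Real.exp (μ * z.1)) -
        a₂ / μ * Real.exp (μ * p₁) + 2 * (a₂ / μ) * Real.exp (μ * (1 + z.1 + zeroGap μ - z.2.1)))
      (by fun_prop) (by fun_prop) (by
        simp only
        -- In the limit the margin `final` says exp(μT) F(h) > 0, which holds because F(h) = h > 0.
        have h1 := exp_mul_stepMap (p₁ := p₁) (p₂ := p₂) (a₂ := a₂) hμ ha₁ hθ
        rw [hfix] at h1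
        have h2 : Real.exp (μ * (1 + θ + zeroGap μ - 0)) =
            Real.exp (μ * θ) * zeroGapExp μ * Real.exp μ := by
          rw [← exp_mul_zeroGap hμ, ← Real.exp_add, ← Real.exp_add]; congr 1; ring
        have h3 : 0 < Real.exp (μ * (p₁ + p₂)) * h := mul_pos (Real.exp_pos _) hh
        rw [h2, zero_add]
        rw [h1] at h3
        have h4 : (a₁ - a₂) / μ * Real.exp (μ * p₁) =
          a₁ / μ * Real.exp (μ * p₁) - a₂ / μ * Real.exp (μ * p₁) := by ring
        linarith)] with z c1 c2 c3 c4 c5 c6 c7 c8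
  exact ⟨c1.le, c2.le, c3.le, c4, c5.le, c6.le, c7, c8⟩

end Affine

end DelayEq

namespace DelayEq

/-! ### Assembly for one smoothing and choice of the constants -/

section Main

variable {μ a₁ a₂ p₁ p₂ δ η ρ hs r ε : ℝ} {a f : ℝ → ℝ}

/-- The conclusions for one smoothing, in terms of the affine one-dimensional map. -/
lemma exists_periodMap_and_solution (hμ : 0 < μ) (ha₁ : 0 < a₁) (ha₂ : 0 < a₂) (hρ : 0 < ρ)
    (hf : IsSmoothFeedback μ a₁ δ f) (ha : IsSmoothCoefficient μ a₁ a₂ p₁ p₂ ρ a)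
    (hw : Window μ a₁ δ η)
    (hr : ∀ h, |h - hs| < r → 0 < h ∧ Margins μ a₁ a₂ p₁ p₂ δ η ρ (firstZero μ a₁ h))
    {lam β ht : ℝ} (hlam : lam = smoothSlope μ a₁ a₂ p₁ p₂ (defect μ a₁ f η))
    (hβ : β = smoothConst μ a₁ a₂ p₁ p₂ (defect μ a₁ f η))
    (hlam1 : lam ≠ 1) (hht : lam * ht + β = ht) (htr : |ht - hs| < r) :
    ∃ P : C0 → C0, IsPeriodMap μ a f (p₁ + p₂) P ∧
      (∀ φ : C0, (∀ θ, δ ≤ φ θ) → |ev0 φ - hs| < r → ev0 (P φ) = scalarMap P (ev0 φ)) ∧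
      ∃ (p : ℝ → ℝ) (φt : C0) (M : C0 →L[ℝ] C0),
        (∀ q : ℝ → ℝ, (IsPeriodicSolution μ a f (p₁ + p₂) q ∧
          (∀ θ ∈ Set.Icc (-1 : ℝ) 0, δ ≤ q θ) ∧ |q 0 - hs| < r) ↔ q = p) ∧
        (∀ θ : Set.Icc (-1 : ℝ) 0, φt θ = p θ) ∧ ev0 φt = ht ∧
        (∀ h : ℝ, (|h - hs| < r ∧ scalarMap P h = h) ↔ h = ht) ∧
        P φt = φt ∧ HasDerivAt (scalarMap P) lam ht ∧ HasFDerivAt P M φt ∧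
        (lam ≠ 0 → ∃ W : Set C0, IsOneDimSubmanifold W ∧ φt ∈ W ∧
          (∃ U ∈ nhds φt, Set.MapsTo P U W) ∧
          (Module.End.eigenspace (M : C0 →ₗ[ℝ] C0) lam : Set C0) = tangentVectors W φt ∧
          Module.finrank ℝ (Module.End.eigenspace (M : C0 →ₗ[ℝ] C0) lam) = 1 ∧
          IsCompl (Module.End.eigenspace (M : C0 →ₗ[ℝ] C0) 0)
            (Module.End.eigenspace (M : C0 →ₗ[ℝ] C0) lam)) ∧
        (|lam| < 1 → IsAsymptoticallyStable μ a f p) := by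
  have hδ := hw.δ_pos
  have hfC : ContDiff ℝ 1 f := hf.smooth.of_le (by exact_mod_cast le_top)
  have hac := ha.smooth.continuous
  obtain ⟨K, hK⟩ := hf.exists_lipschitzWith hδ
  have hT1 : 1 < p₁ + p₂ := by
    have hm := (hr ht htr).2
    linarith [hm.finish, hm.start, one_lt_zeroGap hμ, hw.η_pos]
  have hT : 0 < p₁ + p₂ := by linarith
  obtain ⟨A, hA⟩ := exists_abs_le_of_periodic ha.periodic hT hac
  obtain ⟨P, hP⟩ := exists_isPeriodMap hμ hT.le hac hA hK
  set I : Set ℝ := Metric.ball hs r with hI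
  have hmemI : ∀ h, h ∈ I ↔ |h - hs| < r := fun h => by rw [hI, Metric.mem_ball, Real.dist_eq]
  set G : ℝ → C0 := fun h => branchSegment μ a₁ hac hfC.continuous (p₁ + p₂) (firstZero μ a₁ h)
    with hG
  have hGapp : ∀ h θ, G h θ = branch μ a₁ a f (firstZero μ a₁ h) (p₁ + p₂ + θ) := fun _ _ => rfl
  have hGC : ContDiffOn ℝ 1 G I :=
    (contDiff_branchSegment hμ hac hfC (p₁ + p₂)).comp_contDiffOn
      ((contDiffOn_firstZero hμ ha₁).mono fun h hh => (hr h ((hmemI h).1 hh)).1)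
  have hGaff : ∀ h ∈ I, ev0 (G h) = lam * h + β := fun h hh => by
    obtain ⟨h0, hm⟩ := hr h ((hmemI h).1 hh)
    have := branch_period hμ ha₁ hρ hf ha hw hm (exp_firstZero hμ ha₁ h0)
    rw [hlam, hβ, ← this, ev0, hGapp]
    simp
  have hGδ : ∀ h ∈ I, ∀ θ, δ < G h θ := fun h hh θ => by
    rw [hGapp]
    exact lt_branch_last hμ ha₁ ha₂ hρ hf ha hw (hr h ((hmemI h).1 hh)).2
      (by linarith [θ.2.1]) (by linarith [θ.2.2])
  have hPG : ∀ φ : C0, (∀ θ, δ ≤ φ θ) → ev0 φ ∈ I → P φ = G (ev0 φ) := by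
    intro φ hφ hφI
    obtain ⟨h0, hm⟩ := hr _ ((hmemI _).1 hφI)
    obtain ⟨x, hx⟩ := (hP φ).1
    ext θ
    rw [(hP φ).2 x hx θ, hGapp]
    exact hx.eq_branch hμ ha₁ ha₂ hρ hf ha hw hm hφ (exp_firstZero hμ ha₁ h0).symm
      (by linarith [θ.2.1]) (by linarith [θ.2.2])
  -- Constant states h with h in I are thus admissible, so the scalar map is computed by G.
  have hδI : ∀ h ∈ I, δ ≤ h := by
    intro h hh
    obtain ⟨h0, hm⟩ := hr h ((hmemI h).1 hh)
    have h1 := hm.initial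
    rw [exp_firstZero hμ ha₁ h0] at h1
    have h2 : 1 ≤ Real.exp (μ * ρ) := Real.one_le_exp (by positivity)
    have h3 : 0 ≤ 2 * max a₁ a₂ * (ρ * Real.exp (μ * ρ)) := by
      have : 0 < max a₁ a₂ := lt_max_of_lt_left ha₁
      positivity
    nlinarith
  have hscal : ∀ h ∈ I, P (ContinuousMap.const _ h) = G h := fun h hh =>
    hPG (ContinuousMap.const _ h) (fun _ => hδI h hh) hh
  have hscal' : ∀ h ∈ I, scalarMap P h = lam * h + β := fun h hh => by
    rw [scalarMap, hscal h hh, hGaff h hh]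
  have htI : ht ∈ I := (hmemI ht).2 htr
  have hIo : IsOpen I := Metric.isOpen_ball
  have hev : ev0 (G ht) = ht := by rw [hGaff ht htI, hht]
  have hPφ : P (G ht) = G ht := by
    rw [hPG (G ht) (fun θ => (hGδ ht htI θ).le) (by rwa [hev]), hev]
  have hfixuniq : ∀ h, lam * h + β = h → h = ht := by
    intro h hh
    have : (lam - 1) * (h - ht) = 0 := by linear_combination hh - hht
    exact sub_eq_zero.1 ((mul_eq_zero.1 this).resolve_left (sub_ne_zero.2 hlam1))
  obtain ⟨p, hp, hpφ⟩ := hP.exists_isPeriodicSolution hμ hT hac ha.periodic hA hK hPφ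
  have hp0 : p 0 = ht := by
    have := hpφ ⟨0, by norm_num⟩
    rw [← hev, ev0, this]
  -- a neighbourhood of the fixed point
  obtain ⟨c, hc, hcG⟩ : ∃ c, δ < c ∧ ∀ θ, c ≤ G ht θ := by
    obtain ⟨θ₀, -, hθ₀⟩ := isCompact_univ.exists_isMinOn ⟨⟨0, by norm_num⟩, mem_univ _⟩
      (G ht).continuous.continuousOn
    exact ⟨G ht θ₀, hGδ ht htI θ₀, fun θ => hθ₀ (mem_univ θ)⟩
  set r₀ := min (c - δ) (r - |ht - hs|) with hr₀
  have hr₀0 : 0 < r₀ := lt_min (by linarith) (by linarith)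
  have hnear : ∀ ψ : C0, dist ψ (G ht) < r₀ → (∀ θ, δ ≤ ψ θ) ∧ ev0 ψ ∈ I := by
    intro ψ hψ
    refine ⟨fun θ => ?_, (hmemI _).2 ?_⟩
    · have h1 := (ContinuousMap.dist_apply_le_dist (f := ψ) (g := G ht) θ).trans_lt
        (hψ.trans_le (min_le_left _ _))
      rw [Real.dist_eq] at h1
      linarith [(abs_lt.1 h1).1, hcG θ]
    · have h1 := (abs_ev0_sub_le ψ (G ht)).trans_lt (hψ.trans_le (min_le_right _ _))
      rw [hev] at h1
      calc |ev0 ψ - hs| ≤ |ev0 ψ - ht| + |ht - hs| := abs_sub_le _ _ _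
        _ < r := by linarith
  have hPnear : ∀ ψ : C0, dist ψ (G ht) < r₀ → P ψ = G (ev0 ψ) := fun ψ hψ =>
    hPG ψ (hnear ψ hψ).1 (hnear ψ hψ).2
  have hGd : HasDerivAt G (deriv G ht) ht :=
    ((hGC.contDiffAt (hIo.mem_nhds htI)).differentiableAt one_ne_zero).hasDerivAt
  set ev : C0 →L[ℝ] ℝ := ContinuousMap.evalCLM ℝ (⟨0, by norm_num⟩ : Icc (-1 : ℝ) 0) with hevL
  have hevapp : ∀ ψ, ev ψ = ev0 ψ := fun _ => rfl
  have hevaff : ∀ h ∈ I, ev (G h) = lam * h + β := hGaff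
  have hevv : ev (deriv G ht) = lam := ev_deriv_eq hIo htI hevaff hGd
  refine ⟨P, hP, fun φ hφ hφr => ?_, p, G ht, ev.smulRight (deriv G ht), fun q => ⟨?_, ?_⟩,
    hpφ, hev, fun h => ⟨?_, ?_⟩, hPφ, ?_, ?_, fun hlam0 => ⟨G '' I, ?_, ⟨ht, htI, rfl⟩, ?_, ?_, ?_,
      isCompl_eigenspace_smulRight hevv hlam0⟩, fun hlam' => ?_⟩
  · have hφI := (hmemI _).2 hφr
    rw [hPG φ hφ hφI, scalarMap, hscal _ hφI]
  -- The initial state of a competitor is a fixed point of P, hence equals G at its evaluation, and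
  -- that evaluation is the fixed point of the affine map.
  · rintro ⟨hq, hqδ, hqr⟩
    set ψ := segment q 0 hq.continuous.continuousOn with hψ
    have hψq : ∀ θ : Icc (-1 : ℝ) 0, ψ θ = q θ := fun θ => congrArg q (zero_add _)
    have hψ0 : ev0 ψ = q 0 := hψq ⟨0, by norm_num⟩
    have hψI : ev0 ψ ∈ I := by rw [hψ0]; exact (hmemI _).2 hqr
    have h1 : P ψ = ψ := hP.apply_periodic hq hψq
    have h2 : P ψ = G (ev0 ψ) := hPG ψ (fun θ => by rw [hψq]; exact hqδ θ θ.2) hψI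
    have h3 : ev0 ψ = ht := by
      apply hfixuniq
      rw [← hGaff _ hψI, ← h2, h1]
    have h4 : ψ = G ht := by rw [← h1, h2, h3]
    exact hq.eq_of_initial hμ hT hac hA hK hp (fun θ => by rw [← h4]; exact hψq θ) hpφ
  · rintro rfl
    refine ⟨hp, fun θ hθ => ?_, by rw [hp0]; exact htr⟩
    have := hpφ ⟨θ, hθ⟩
    rw [← this]
    exact (hGδ ht htI _).le
  · rintro ⟨h1, h2⟩
    rw [hscal' h ((hmemI h).2 h1)] at h2
    exact hfixuniq h h2
  · rintro rfl
    exact ⟨htr, by rw [hscal' h htI, hht]⟩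
  · have h1 : HasDerivAt (fun h => lam * h + β) lam ht := by
      simpa using ((hasDerivAt_id ht).const_mul lam).add_const β
    exact h1.congr_of_eventuallyEq (Filter.eventually_of_mem (hIo.mem_nhds htI) hscal')
  · have h1 : HasFDerivAt (fun ψ => G (ev ψ)) (ev.smulRight (deriv G ht)) (G ht) := by
      have hGd' : HasFDerivAt G (.toSpanSingleton ℝ (deriv G ht)) (ev (G ht)) := by
        rw [hevapp, hev]; exact hGd.hasFDerivAt
      refine (hGd'.comp (G ht) ev.hasFDerivAt).congr_fderiv ?_
      ext ψ
      simp
    exact h1.congr_of_eventuallyEq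
      (Filter.eventually_of_mem (Metric.ball_mem_nhds _ hr₀0) fun ψ hψ => hPnear ψ hψ)
  · exact isOneDimSubmanifold_image (e := ContinuousMap.const _ 1) rfl hIo hGC hevaff hlam0
  · exact ⟨Metric.ball (G ht) r₀, Metric.ball_mem_nhds _ hr₀0, fun ψ hψ =>
      ⟨ev0 ψ, (hnear ψ hψ).2, (hPnear ψ hψ).symm⟩⟩
  · rw [eigenspace_smulRight hevv hlam0, tangentVectors_image hIo htI hevaff hlam0 hGd]
  · rw [eigenspace_smulRight hevv hlam0]
    exact finrank_span_singleton (by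
      intro h0
      rw [h0, map_zero] at hevv
      exact hlam0 hevv.symm)
  · refine hP.isAsymptoticallyStable hμ hT hac ha.periodic hA hK hp hpφ hr₀0 hPnear
      (by rw [hev]) (by rw [hev]; exact hGd.continuousAt) hlam' fun ψ hψ => ?_
    rw [hPnear ψ hψ, hGaff _ (hnear ψ hψ).2, hev]
    linear_combination hht

/-- For small defects, the one-dimensional map has all required properties. -/
lemma eventually_defect (hm1 : mCoef μ a₁ a₂ p₁ p₂ ≠ 1) (hm : -1 < mCoef μ a₁ a₂ p₁ p₂)
    (hfix : stepMap μ a₁ a₂ p₁ p₂ hs = hs) (hε : 0 < ε) (hr0 : 0 < r) :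
    ∀ᶠ κ in 𝓝 (0 : ℝ), smoothSlope μ a₁ a₂ p₁ p₂ κ ≠ 1 ∧
      |smoothConst μ a₁ a₂ p₁ p₂ κ / (1 - smoothSlope μ a₁ a₂ p₁ p₂ κ) - hs| < min ε r ∧
      |smoothSlope μ a₁ a₂ p₁ p₂ κ - mCoef μ a₁ a₂ p₁ p₂| < ε ∧
      (mCoef μ a₁ a₂ p₁ p₂ ≠ 0 → smoothSlope μ a₁ a₂ p₁ p₂ κ ≠ 0) ∧
      (mCoef μ a₁ a₂ p₁ p₂ < 1 → |smoothSlope μ a₁ a₂ p₁ p₂ κ| < 1) := by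
  have hc1 : Continuous (smoothSlope μ a₁ a₂ p₁ p₂) := by unfold smoothSlope; fun_prop
  have hc2 : Continuous (smoothConst μ a₁ a₂ p₁ p₂) := by unfold smoothConst; fun_prop
  have h1 : smoothSlope μ a₁ a₂ p₁ p₂ 0 = mCoef μ a₁ a₂ p₁ p₂ := by simp [smoothSlope]
  have h2 : smoothConst μ a₁ a₂ p₁ p₂ 0 = bCoef μ a₁ a₂ p₁ p₂ := by simp [smoothConst]
  have ht1 : Tendsto (smoothSlope μ a₁ a₂ p₁ p₂) (𝓝 0) (𝓝 (mCoef μ a₁ a₂ p₁ p₂)) := by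
    rw [← h1]; exact hc1.tendsto 0
  have ht2 : Tendsto (smoothConst μ a₁ a₂ p₁ p₂) (𝓝 0) (𝓝 (bCoef μ a₁ a₂ p₁ p₂)) := by
    rw [← h2]; exact hc2.tendsto 0
  have hne : 1 - mCoef μ a₁ a₂ p₁ p₂ ≠ 0 := sub_ne_zero.2 hm1.symm
  have hval : bCoef μ a₁ a₂ p₁ p₂ / (1 - mCoef μ a₁ a₂ p₁ p₂) = hs := by
    rw [div_eq_iff hne]
    rw [stepMap] at hfix
    linarith
  have ht3 := ht2.div (ht1.const_sub 1) hne
  rw [hval] at ht3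
  have e1 := ht1.eventually_ne hm1
  have e2 := Metric.tendsto_nhds.1 ht3 (min ε r) (lt_min hε hr0)
  have e3 := Metric.tendsto_nhds.1 ht1 ε hε
  have e4 : ∀ᶠ κ in 𝓝 (0 : ℝ), mCoef μ a₁ a₂ p₁ p₂ ≠ 0 → smoothSlope μ a₁ a₂ p₁ p₂ κ ≠ 0 := by
    by_cases h : mCoef μ a₁ a₂ p₁ p₂ = 0
    · exact .of_forall fun _ h' => absurd h h'
    · filter_upwards [ht1.eventually_ne h] with κ hκ _ using hκ
  have e5 : ∀ᶠ κ in 𝓝 (0 : ℝ), mCoef μ a₁ a₂ p₁ p₂ < 1 → |smoothSlope μ a₁ a₂ p₁ p₂ κ| < 1 := by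
    by_cases h : mCoef μ a₁ a₂ p₁ p₂ < 1
    · filter_upwards [ht1.abs.eventually_lt_const (abs_lt.2 ⟨hm, h⟩)] with κ hκ _ using hκ
    · exact .of_forall fun _ h' => absurd h' h
  filter_upwards [e1, e2, e3, e4, e5] with κ k1 k2 k3 k4 k5
  rw [Real.dist_eq] at k2 k3
  exact ⟨k1, k2, k3, k4, k5⟩

/-- The bound for the defect in terms of the window tends to `0`. -/
lemma tendsto_defect_bound (hμ : 0 < μ) : Tendsto (fun η : ℝ =>
    2 * η * Real.exp (μ * (zeroGap μ + η)) +
      |(Real.exp (μ * (zeroGap μ - η)) + Real.exp (μ * (zeroGap μ + η)) - 2 * zeroGapExp μ) / μ|)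
    (𝓝 0) (𝓝 0) := by
  have hc : Continuous (fun η : ℝ => 2 * η * Real.exp (μ * (zeroGap μ + η)) +
      |(Real.exp (μ * (zeroGap μ - η)) + Real.exp (μ * (zeroGap μ + η)) - 2 * zeroGapExp μ) / μ|) := by
    fun_prop
  have := hc.tendsto 0
  simp only [mul_zero, zero_mul, sub_zero, add_zero, exp_mul_zeroGap hμ, zero_add] at this
  rw [show zeroGapExp μ + zeroGapExp μ - 2 * zeroGapExp μ = 0 by ring, zero_div, abs_zero] at this
  exact this

/-- Constants `r`, `κ₀` for which all margins hold. -/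
lemma exists_margins (hμ : 0 < μ) (ha₁ : 0 < a₁) (ha₂ : 0 < a₂) (hh : 0 < hs)
    (h₁ : secondZero μ a₁ hs < p₁) (h₂ : p₁ < secondZero μ a₁ hs + 1)
    (h₃ : secondZero μ a₁ hs + 1 < p₁ + p₂) (hfix : stepMap μ a₁ a₂ p₁ p₂ hs = hs) :
    ∃ r > 0, ∃ κ₀ > 0, ∀ h δ η ρ, |h - hs| < r → |δ| < κ₀ → |η| < κ₀ → |ρ| < κ₀ →
      0 < h ∧ Margins μ a₁ a₂ p₁ p₂ δ η ρ (firstZero μ a₁ h) := by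
  obtain ⟨κ₀, hκ₀, hκ⟩ := Metric.eventually_nhds_iff.1
    (eventually_margins hμ ha₁ ha₂ hh h₁ h₂ h₃ hfix)
  have hc : ContinuousAt (firstZero μ a₁) hs :=
    (contDiffOn_firstZero hμ ha₁).continuousOn.continuousAt (Ioi_mem_nhds hh)
  obtain ⟨r, hr, hrf⟩ := Metric.continuousAt_iff.1 hc κ₀ hκ₀
  refine ⟨min r hs, lt_min hr hh, κ₀, hκ₀, fun h δ η ρ k1 k2 k3 k4 => ⟨?_, ?_⟩⟩
  · linarith [(abs_lt.1 (k1.trans_le (min_le_right _ _))).1]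
  · have h1 := hrf (x := h) (by rw [Real.dist_eq]; exact k1.trans_le (min_le_left _ _))
    exact hκ (y := (firstZero μ a₁ h, η, δ, ρ)) (by
      simp only [Prod.dist_eq, Real.dist_eq, sub_zero, max_lt_iff] at h1 ⊢
      exact ⟨h1, k3, k2, k4⟩)

lemma eventually_small (hμ : 0 < μ) : ∀ᶠ η in 𝓝 (0 : ℝ),
    Real.exp (μ * (1 + 2 * η)) + 1 < 2 * Real.exp (μ * (1 - η)) := by
  refine ContinuousAt.eventually_lt (by fun_prop) (by fun_prop) ?_
  have : 1 < Real.exp μ := Real.one_lt_exp_iff.2 hμ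
  simp only [mul_zero, add_zero, sub_zero, mul_one]
  linarith

end Main

end DelayEq
theorem theorem4p6 (μ a₁ a₂ p₁ p₂ hs : ℝ) (hμ : 0 < μ) (ha₁ : 0 < a₁) (ha₂ : 0 < a₂)
    (hs_pos : 0 < hs)
    (h_shape₁ : DelayEq.secondZero μ a₁ hs < p₁)
    (h_shape₂ : p₁ < DelayEq.secondZero μ a₁ hs + 1)
    (h_shape₃ : DelayEq.secondZero μ a₁ hs + 1 < p₁ + p₂)
    (h_fixed : DelayEq.stepMap μ a₁ a₂ p₁ p₂ hs = hs)
    (hm : DelayEq.mCoef μ a₁ a₂ p₁ p₂ ≠ 1) :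
    ∃ r > 0, ∃ ρ₀ > 0, ∀ ε > 0, ∃ δ₀ > 0,
      ∀ (δ ρ : ℝ) (a f : ℝ → ℝ), 0 < δ → δ < δ₀ → 0 < ρ → ρ < ρ₀ →
        DelayEq.IsSmoothFeedback μ a₁ δ f →
        DelayEq.IsSmoothCoefficient μ a₁ a₂ p₁ p₂ ρ a →
        ∃ P : DelayEq.C0 → DelayEq.C0, DelayEq.IsPeriodMap μ a f (p₁ + p₂) P ∧
          (∀ φ : DelayEq.C0, (∀ θ, δ ≤ φ θ) → |DelayEq.ev0 φ - hs| < r →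
            DelayEq.ev0 (P φ) = DelayEq.scalarMap P (DelayEq.ev0 φ)) ∧
          ∃ (p : ℝ → ℝ) (φt : DelayEq.C0) (ht lam : ℝ) (M : DelayEq.C0 →L[ℝ] DelayEq.C0),
            -- the periodic solution, unique among those with initial state `≥ δ` and `p 0` near `hs`
            (∀ q : ℝ → ℝ, (DelayEq.IsPeriodicSolution μ a f (p₁ + p₂) q ∧
              (∀ θ ∈ Set.Icc (-1 : ℝ) 0, δ ≤ q θ) ∧ |q 0 - hs| < r) ↔ q = p) ∧
            -- its initial state, and the unique fixed point of the one-dimensional map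
            (∀ θ : Set.Icc (-1 : ℝ) 0, φt θ = p θ) ∧ DelayEq.ev0 φt = ht ∧
            (∀ h : ℝ, (|h - hs| < r ∧ DelayEq.scalarMap P h = h) ↔ h = ht) ∧
            P φt = φt ∧
            -- the derivatives, and the limits as `δ → 0`
            HasDerivAt (DelayEq.scalarMap P) lam ht ∧ HasFDerivAt P M φt ∧
            |ht - hs| < ε ∧ |lam - DelayEq.mCoef μ a₁ a₂ p₁ p₂| < ε ∧
            -- submanifold and invariant splitting
            (DelayEq.mCoef μ a₁ a₂ p₁ p₂ ≠ 0 → lam ≠ 0 ∧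
              ∃ W : Set DelayEq.C0, DelayEq.IsOneDimSubmanifold W ∧ φt ∈ W ∧
                (∃ U ∈ nhds φt, Set.MapsTo P U W) ∧
                (Module.End.eigenspace (M : DelayEq.C0 →ₗ[ℝ] DelayEq.C0) lam : Set DelayEq.C0) =
                  DelayEq.tangentVectors W φt ∧
                Module.finrank ℝ
                  (Module.End.eigenspace (M : DelayEq.C0 →ₗ[ℝ] DelayEq.C0) lam) = 1 ∧
                IsCompl (Module.End.eigenspace (M : DelayEq.C0 →ₗ[ℝ] DelayEq.C0) 0)
                  (Module.End.eigenspace (M : DelayEq.C0 →ₗ[ℝ] DelayEq.C0) lam)) ∧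
            -- stability
            (DelayEq.mCoef μ a₁ a₂ p₁ p₂ < 1 → DelayEq.IsAsymptoticallyStable μ a f p) := by
  obtain ⟨r, hr0, κ₀, hκ₀, hmar⟩ :=
    DelayEq.exists_margins hμ ha₁ ha₂ hs_pos h_shape₁ h_shape₂ h_shape₃ h_fixed
  -- The defect does not involve ρ, so the bound on ρ comes from the margins alone and can be fixed
  -- before ε.
  refine ⟨r, hr0, κ₀, hκ₀, fun ε hε => ?_⟩
  have hm0 : -1 < DelayEq.mCoef μ a₁ a₂ p₁ p₂ := by
    rw [DelayEq.secondZero_eq hμ ha₁] at h_shape₃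
    exact DelayEq.neg_one_lt_mCoef hμ ha₁ ha₂ (DelayEq.firstZero_pos hμ ha₁ hs_pos) h_shape₃
  obtain ⟨κ₁, hκ₁, hdef⟩ := Metric.eventually_nhds_iff.1
    (DelayEq.eventually_defect hm hm0 h_fixed hε hr0)
  -- the half-length of the windows
  obtain ⟨η, ⟨⟨hη1, hη2⟩, hη3, hη4⟩, hη0⟩ :=
    ((((DelayEq.tendsto_defect_bound hμ).eventually_lt_const hκ₁).and
      (DelayEq.eventually_small hμ)).and ((eventually_lt_nhds hκ₀).and
        (eventually_lt_nhds (by norm_num : (0 : ℝ) < 1 / 3)))).filter_mono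
          (nhdsWithin_le_nhds (s := Ioi 0)) |>.and (eventually_mem_nhdsWithin) |>.exists
  have hη0' : 0 < η := hη0
  have hexp : 0 < 1 - Real.exp (-(μ * η)) := by
    have : Real.exp (-(μ * η)) < 1 := Real.exp_lt_one_iff.2 (by linarith [mul_pos hμ hη0'])
    linarith
  -- The half-length η was chosen first, from ε; the second entry is the window condition `width`
  -- solved for δ.
  refine ⟨min κ₀ (a₁ / μ * (1 - Real.exp (-(μ * η)))), by positivity,
    fun δ ρ a f hδ hδ0 hρ hρ0 hf ha => ?_⟩
  have hw : DelayEq.Window μ a₁ δ η := by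
    refine ⟨hδ, hη0', hη4.le, hη2.le, ?_⟩
    have h1 := hδ0.le.trans (min_le_right _ _)
    have h2 := mul_le_mul_of_nonneg_left h1 (by positivity : 0 ≤ μ / a₁)
    calc μ * δ / a₁ = μ / a₁ * δ := by ring
      _ ≤ _ := h2
      _ = _ := by field_simp
  have hmar' : ∀ h, |h - hs| < r → 0 < h ∧
      DelayEq.Margins μ a₁ a₂ p₁ p₂ δ η ρ (DelayEq.firstZero μ a₁ h) := fun h hh =>
    hmar h δ η ρ hh (by rw [abs_of_pos hδ]; exact hδ0.trans_le (min_le_left _ _))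
      (by rwa [abs_of_pos hη0']) (by rwa [abs_of_pos hρ])
  obtain ⟨k1, k2, k3, k4, k5⟩ := hdef (y := DelayEq.defect μ a₁ f η) (by
    rw [Real.dist_eq, sub_zero]
    exact (DelayEq.abs_defect_le hμ hf hw).trans_lt hη1)
  set lam := DelayEq.smoothSlope μ a₁ a₂ p₁ p₂ (DelayEq.defect μ a₁ f η) with hlam
  set β := DelayEq.smoothConst μ a₁ a₂ p₁ p₂ (DelayEq.defect μ a₁ f η) with hβ
  have hht : lam * (β / (1 - lam)) + β = β / (1 - lam) := by
    have : 1 - lam ≠ 0 := sub_ne_zero.2 k1.symm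
    field_simp
    ring
  obtain ⟨P, hP, hPs, p, φt, M, c1, c2, c3, c4, c5, c6, c7, c8, c9⟩ :=
    DelayEq.exists_periodMap_and_solution hμ ha₁ ha₂ hρ hf ha hw hmar' hlam hβ k1 hht
      (k2.trans_le (min_le_right _ _))
  exact ⟨P, hP, hPs, p, φt, β / (1 - lam), lam, M, c1, c2, c3, c4, c5, c6, c7,
    k2.trans_le (min_le_left _ _), k3, fun h => ⟨k4 h, c8 (k4 h)⟩, fun h => c9 (k5 h)⟩
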